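/- All modules are finitely generated. Let $R$ be a Gorenstein local ring (commutative and Noetherian), let $\operatorname{mod} R$ be the category of finitely generated $R$-modules, and let $\operatorname{CM}(R)$ be the full subcategory of maximal Cohen–Macaulay modules (including $0$). For a full, isomorphism-closed subcategory $\mathcal X$ of $\operatorname{mod} R$, let $[\mathcal X]$ consist of the direct summands of finite direct sums of copies of $R$ and of modules $\Omega^iX$ with $i\ge 0$ and $X\in\mathcal X$, where $\Omega^i$ denotes the $i$-th syzygy in a minimal free resolution. Let $\mathcal X\circ\mathcal Y$ consist of the modules $M$ that fit into an exact sequence $0\to X\to M\to Y\to 0$ with $X\in\mathcal X$, $Y\in\mathcal Y$, and put $\mathcal X\bullet\mathcal Y=[[\mathcal X]\circ[\mathcal Y]]$. For a module $C$ put $[C]_1=[\{C\}]$ and $[C]_r=[C]_{r-1}\bullet\{C\}$ for $r\ge 2$. The radius of $\mathcal X$, $\operatorname{radius}\mathcal X\in\mathbb N\cup\{\infty\}$, is the infimum of the integers $n\ge 0$ such that $\mathcal X\subseteq[C]_{n+1}$ for some finitely generated $R$-module $C$. Let $\underline{\operatorname{CM}}(R)$ be the stable category of $\operatorname{CM}(R)$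 (morphisms modulo those that factor through finitely generated projective modules), with its usual triangulated structure: $\Sigma X$ is the cokernel of an embedding of $X$ into a free module with Cohen–Macaulay cokernel, and the distinguished triangles are those isomorphic to a triangle $A\xrightarrow{u}B\to C\to\Sigma A$ in which $0\to B\to C\to\Sigma A\to 0$ is the pushout along $u$ of such a sequence $0\to A\to F\to\Sigma A\to 0$. Its dimension in the sense of Rouquier, $\dim\underline{\operatorname{CM}}(R)\in\mathbb N\cup\{\infty\}$, is the infimum of the integers $n\ge 0$ such that $\underline{\operatorname{CM}}(R)=\langle G\rangle_{n+1}$ for some object $G$. Here $\langle\mathcal Y\rangle$ is the smallest full subcategory that contains $\mathcal Y$ and is closed under isomorphisms, finite direct sums, direct summands and $\Sigma^{\pm1}$; $\langle G\rangle_1=\langle\{G\}\rangle$; and for $r\ge 2$, $\langle G\rangle_r=\langle\mathcal Y_r\rangle$, where $\mathcal Y_r$ consists of the objects $Y$ in a distinguished triangle $X\to Y\to Z\to\Sigma X$ with $X\in\langle G\rangle_{r-1}$ and $Z\in\langle G\rangle_1$. Then: 1. $\dim\underline{\operatorname{CM}}(R)\le\operatorname{radius}\operatorname{CM}(R)$.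 2. Equality holds if $R$ is a hypersurface, i.e. if the completion $\widehat R$ of $R$ at its maximal ideal is isomorphic to $S/(f)$ for some complete regular local ring $S$ and some $f\in S$. -/

import Mathlib

open CategoryTheory CategoryTheory.Limits

noncomputable section

universe u

namespace CMRadius

/-! ### Rings and maximal Cohen-Macaulay modules -/

/-- A Noetherian local ring is Gorenstein if it has finite injective dimension as a module over
itself. -/
class IsGorensteinLocalRing (R : Type u) [CommRing R] : Prop
    extends IsLocalRing R, IsNoetherianRing R where
  exists_hasInjectiveDimensionLE : ∃ n : ℕ, HasInjectiveDimensionLE (ModuleCat.of R R) n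

/-- A local ring is a hypersurface if its completion is isomorphic to the quotient of a complete
regular local ring by a principal ideal. -/
def IsHypersurface (R : Type u) [CommRing R] [IsLocalRing R] : Prop :=
  ∃ (S : Type u) (_ : CommRing S) (_ : IsRegularLocalRing S)
    (_ : IsAdicComplete (IsLocalRing.maximalIdeal S) S) (f : S),
    Nonempty (AdicCompletion (IsLocalRing.maximalIdeal R) R ≃+* S ⧸ Ideal.span {f})

section Modules

variable (R : Type u) [CommRing R] [IsLocalRing R]

/-- The depth of a finitely generated module over a local ring: the supremum of the lengths of
the regular sequences on `M` in the maximal ideal. (By Nakayama, for `M ≠ 0` finitely generated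
a weakly regular sequence in the maximal ideal is regular; the zero module has depth `⊤`.) -/
def depth (M : Type u) [AddCommGroup M] [Module R M] : ℕ∞ :=
  ⨆ (rs : List R) (_ : ∀ r ∈ rs, r ∈ IsLocalRing.maximalIdeal R)
    (_ : RingTheory.Sequence.IsWeaklyRegular M rs), (rs.length : ℕ∞)

/-- The (maximal) Cohen-Macaulay modules: finitely generated modules which are zero or whose
depth is the Krull dimension of the ring. -/
def isCM : ObjectProperty (ModuleCat.{u} R) := fun M =>
  Module.Finite R M ∧ (Subsingleton M ∨ ((depth R M : ℕ∞) : WithBot ℕ∞) = ringKrullDim R)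

/-! ### Balls and the radius of a subcategory of modules

Subcategories of the category `mod R` of finitely generated modules are given by
isomorphism-invariant properties of modules. -/

variable {R}

/-- The strict full subcategory on a single module. -/
def single (C : ModuleCat.{u} R) : ObjectProperty (ModuleCat.{u} R) :=
  fun M => Nonempty (M ≃ₗ[R] C)

/-- The additive closure: direct summands of finite direct sums of modules in `P`. -/
def addClosure (P : ObjectProperty (ModuleCat.{u} R)) : ObjectProperty (ModuleCat.{u} R) :=
  fun M => ∃ (n : ℕ) (X : Fin n → ModuleCat.{u} R) (N : ModuleCat.{u} R),
    (∀ i, P (X i)) ∧ Nonempty ((M × N) ≃ₗ[R] (∀ i, X i))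

/-- `N` is a first syzygy of `M`: there is an exact sequence `0 → N → Rⁿ → M → 0` with the image
of `N` contained in `𝔪 Rⁿ`. -/
def IsFirstSyzygy (N M : ModuleCat.{u} R) : Prop :=
  ∃ (n : ℕ) (i : N →ₗ[R] (Fin n → R)) (p : (Fin n → R) →ₗ[R] M),
    Function.Injective i ∧ Function.Exact i p ∧ Function.Surjective p ∧
      LinearMap.range i ≤ IsLocalRing.maximalIdeal R • (⊤ : Submodule R (Fin n → R))

/-- `IsSyzygy k N M`: `N` is isomorphic to the `k`-th syzygy in a minimal free resolution
of `M`. -/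
def IsSyzygy : ℕ → ModuleCat.{u} R → ModuleCat.{u} R → Prop
  | 0, N, M => Nonempty (N ≃ₗ[R] M)
  | k + 1, N, M => ∃ L : ModuleCat.{u} R, IsSyzygy k L M ∧ IsFirstSyzygy N L

/-- `[P]`: the additive closure of `R` and all syzygies `Ωⁱ X` with `i ≥ 0` and `X` in `P`. -/
def bracket (P : ObjectProperty (ModuleCat.{u} R)) : ObjectProperty (ModuleCat.{u} R) :=
  addClosure fun M => Nonempty (M ≃ₗ[R] R) ∨ ∃ (i : ℕ) (X : ModuleCat.{u} R), P X ∧ IsSyzygy i M X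

/-- `P ∘ Q`: the modules `M` in an exact sequence `0 → X → M → Y → 0` with `X` in `P` and `Y`
in `Q`. -/
def circ (P Q : ObjectProperty (ModuleCat.{u} R)) : ObjectProperty (ModuleCat.{u} R) :=
  fun M => ∃ (X Y : ModuleCat.{u} R) (f : X →ₗ[R] M) (g : M →ₗ[R] Y), P X ∧ Q Y ∧
    Function.Injective f ∧ Function.Exact f g ∧ Function.Surjective g

/-- `P • Q = [[P] ∘ [Q]]`. -/
def bullet (P Q : ObjectProperty (ModuleCat.{u} R)) : ObjectProperty (ModuleCat.{u} R) :=
  bracket (circ (bracket P) (bracket Q))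

/-- The ball `[P]_r` of radius `r ≥ 1` centered at `P`: `[P]_1 = [P]` and
`[P]_r = [P]_{r-1} • P` for `r ≥ 2`. (The value at `r = 0` is a convention that is not used.) -/
def ball (P : ObjectProperty (ModuleCat.{u} R)) : ℕ → ObjectProperty (ModuleCat.{u} R)
  | 0 => fun M => Subsingleton M
  | 1 => bracket P
  | r + 2 => bullet (ball P (r + 1)) P

/-- The radius of a subcategory of `mod R`: the infimum in `ℕ ∪ {∞}` of the `n ≥ 0` such that
the subcategory is contained in a ball of radius `n + 1` centered at a finitely generated
module. -/
def radius (P : ObjectProperty (ModuleCat.{u} R)) : ℕ∞ :=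
  ⨅ (n : ℕ) (_ : ∃ C : ModuleCat.{u} R, Module.Finite R C ∧ P ≤ ball (single C) (n + 1)), (n : ℕ∞)

end Modules

/-! ### The stable category of Cohen-Macaulay modules -/

section Stable

section

variable {R : Type u} [CommRing R]

/-- A homomorphism which factors through a finitely generated projective module. -/
def FactorsThroughProjective {M N : ModuleCat.{u} R} (f : M ⟶ N) : Prop :=
  ∃ (P : ModuleCat.{u} R) (_ : Module.Finite R P) (_ : Module.Projective R P)
    (a : M ⟶ P) (b : P ⟶ N), a ≫ b = f

lemma FactorsThroughProjective.zero (M N : ModuleCat.{u} R) :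
    FactorsThroughProjective (0 : M ⟶ N) :=
  ⟨ModuleCat.of R PUnit.{u + 1}, inferInstanceAs (Module.Finite R PUnit.{u + 1}),
    inferInstanceAs (Module.Projective R PUnit.{u + 1}), 0, 0, by simp⟩

lemma FactorsThroughProjective.neg {M N : ModuleCat.{u} R} {f : M ⟶ N}
    (hf : FactorsThroughProjective f) : FactorsThroughProjective (-f) := by
  obtain ⟨P, h₁, h₂, a, b, rfl⟩ := hf
  exact ⟨P, h₁, h₂, a, -b, by simp⟩

lemma FactorsThroughProjective.add {M N : ModuleCat.{u} R} {f g : M ⟶ N}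
    (hf : FactorsThroughProjective f) (hg : FactorsThroughProjective g) :
    FactorsThroughProjective (f + g) := by
  obtain ⟨P, h₁, h₂, a, b, rfl⟩ := hf
  obtain ⟨Q, h₃, h₄, c, d, rfl⟩ := hg
  refine ⟨ModuleCat.of R (P × Q), inferInstanceAs (Module.Finite R (P × Q)),
    inferInstanceAs (Module.Projective R (P × Q)), ModuleCat.ofHom (a.hom.prod c.hom),
    ModuleCat.ofHom (b.hom.coprod d.hom), ?_⟩
  ext x
  simp

end

variable (R : Type u) [CommRing R] [IsLocalRing R]

/-- The category `CM(R)`, a full subcategory of the category of modules. -/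
abbrev CMCat : Type (u + 1) := (isCM R).FullSubcategory

/-- Two homomorphisms of Cohen-Macaulay modules are stably equal if their difference factors
through a finitely generated projective module. -/
def stableRel : HomRel (CMCat R) :=
  fun _ _ f g => FactorsThroughProjective (f.hom - g.hom)

instance : Congruence (stableRel R) where
  equivalence :=
    { refl := fun f => by
        simpa [stableRel] using FactorsThroughProjective.zero _ _
      symm := fun {f g} h => by
        simpa [stableRel] using FactorsThroughProjective.neg h
      trans := fun {f g k} h h' => by
        simpa [stableRel] using FactorsThroughProjective.add h h' }
  comp_left := fun {X Y Z} f {g g'} h => by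
    obtain ⟨P, h₁, h₂, a, b, e⟩ := h
    exact ⟨P, h₁, h₂, f.hom ≫ a, b, by simp [e]⟩
  comp_right := fun {X Y Z f f'} g h => by
    obtain ⟨P, h₁, h₂, a, b, e⟩ := h
    refine ⟨P, h₁, h₂, a, b ≫ g.hom, ?_⟩
    rw [← Category.assoc, e]
    simp

/-- The stable category of `CM(R)`: its objects are the Cohen-Macaulay modules, and its morphisms
are the homomorphisms modulo those which factor through finitely generated projective modules. -/
abbrev StableCM : Type (u + 1) := Quotient (stableRel R)

instance : Preadditive (StableCM R) :=
  Quotient.preadditive (stableRel R) fun X Y f₁ f₂ g₁ g₂ h h' => by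
    have := FactorsThroughProjective.add h h'
    rwa [sub_add_sub_comm] at this

/-- The canonical functor from `CM(R)` to its stable category. -/
abbrev toStable : CMCat R ⥤ StableCM R := Quotient.functor (stableRel R)

variable {R}

/-- The exact structure on `CM(R)`: short exact sequences of modules whose terms are all
Cohen-Macaulay. -/
def IsConflation (S : ShortComplex (CMCat R)) : Prop :=
  (S.map (isCM R).ι).ShortExact

/-- `T` is (isomorphic to) the suspension `Σ X` in the stable category: up to isomorphism in the
stable category, there is an exact sequence `0 → X → I → T → 0` of Cohen-Macaulay modules with
`I` projective. -/
def IsSuspension (X T : StableCM R) : Prop :=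
  ∃ S : ShortComplex (CMCat R), IsConflation S ∧ Module.Projective R S.X₂.obj ∧
    Nonempty (X ≅ (toStable R).obj S.X₁) ∧ Nonempty (T ≅ (toStable R).obj S.X₃)

/-- `X ⟶ Y ⟶ Z` are the first two maps of a distinguished triangle `X ⟶ Y ⟶ Z ⟶ Σ X` of the
stable category. The distinguished triangles are those isomorphic to a standard triangle
`A ⟶ B ⟶ C ⟶ Σ A`, which arises from a homomorphism `u : A ⟶ B` by the pushout diagram with
exact rows
```
  0 ⟶ A ⟶ I ⟶ Σ A ⟶ 0
      |u   |     ‖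
  0 ⟶ B ⟶ C ⟶ Σ A ⟶ 0
```
where `I` is projective. -/
def IsDistinguished {X Y Z : StableCM R} (f : X ⟶ Y) (g : Y ⟶ Z) : Prop :=
  ∃ (S S' : ShortComplex (CMCat R)) (φ : S ⟶ S'),
    IsConflation S ∧ Module.Projective R S.X₂.obj ∧ IsConflation S' ∧ IsIso φ.τ₃ ∧
    ∃ (a : X ≅ (toStable R).obj S.X₁) (b : Y ≅ (toStable R).obj S'.X₁)
      (c : Z ≅ (toStable R).obj S'.X₂),
      f ≫ b.hom = a.hom ≫ (toStable R).map φ.τ₁ ∧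
      g ≫ c.hom = b.hom ≫ (toStable R).map S'.f

/-! ### Rouquier's dimension of the stable category -/

/-- `⟨P⟩`: the smallest full subcategory of the stable category which contains `P` and is closed
under isomorphisms, finite direct sums, direct summands and shifts in both directions. (Closure
under isomorphisms is the special case of closure under retracts.) -/
inductive generated (P : ObjectProperty (StableCM R)) : ObjectProperty (StableCM R)
  | of {X : StableCM R} (hX : P X) : generated P X
  | zero {X : StableCM R} (hX : IsZero X) : generated P X
  | sum {X Y : StableCM R} (hX : generated P X) (hY : generated P Y)
      (b : BinaryBicone X Y) (hb : b.IsBilimit) : generated P b.pt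
  | summand {X Y : StableCM R} (hY : generated P Y) (r : Retract X Y) : generated P X
  | suspension {X T : StableCM R} (hX : generated P X) (h : IsSuspension X T) : generated P T
  | desuspension {X T : StableCM R} (hT : generated P T) (h : IsSuspension X T) : generated P X

/-- `P * Q`: the objects `Y` in a distinguished triangle `X ⟶ Y ⟶ Z ⟶ Σ X` with `X` in `P` and
`Z` in `Q`. -/
def star (P Q : ObjectProperty (StableCM R)) : ObjectProperty (StableCM R) :=
  fun Y => ∃ (X Z : StableCM R) (f : X ⟶ Y) (g : Y ⟶ Z), P X ∧ Q Z ∧ IsDistinguished f g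

/-- Rouquier's `⟨P⟩_n`: `⟨P⟩_0 = 0`, `⟨P⟩_1 = ⟨P⟩` and `⟨P⟩_n = ⟨⟨P⟩_{n-1} * ⟨P⟩⟩` for
`n ≥ 2`. -/
def generatedIn (P : ObjectProperty (StableCM R)) : ℕ → ObjectProperty (StableCM R)
  | 0 => fun X => IsZero X
  | 1 => generated P
  | n + 2 => generated (star (generatedIn P (n + 1)) (generated P))

/-- The strict full subcategory of the stable category on a single object. -/
def stableSingle (G : StableCM R) : ObjectProperty (StableCM R) := fun X => Nonempty (X ≅ G)

variable (R) in
/-- Rouquier's dimension of the stable category of `CM(R)`: the infimum in `ℕ ∪ {∞}` of the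
`n ≥ 0` such that the whole category is `⟨G⟩_{n+1}` for some object `G`. -/
def stableDim : ℕ∞ :=
  ⨅ (n : ℕ) (_ : ∃ G : StableCM R, generatedIn (stableSingle G) (n + 1) = ⊤), (n : ℕ∞)

end Stable

end CMRadius

end

open CategoryTheory CategoryTheory.Limits

noncomputable section

universe u

namespace CMRadius

open IsLocalRing RingTheory.Sequence CategoryTheory.Abelian

/-! ### Depth through Ext, and the Cohen–Macaulay condition -/

section Depth

variable {R : Type u} [CommRing R]

/-! Call a class of finitely generated modules good (`IsGood`) if it contains R and is closed under
retracts, finite direct sums and syzygies. Brackets, hence balls around finitely generated modules,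
are least good classes (`IsGood.bracket_le`, `bracket_isGood`). The Cohen–Macaulay (CM) modules
whose stable class lies in a layer ⟨G⟩_r also form a good class, because a syzygy is an inverse
suspension. The Gorenstein hypothesis enters by making R itself CM
(`depthGE_dimNat_of_isGorensteinLocalRing`).

For dim ≤ radius, let CM(R) lie in [C]_{n+1} and let G be a d-th syzygy of C with d = dim R, so that
G is CM. The modules with a d-th syzygy in a good class again form a good class, and by the
horseshoe lemma an extension has a d-th syzygy that is an extension of d-th syzygies. As short exact
sequences of CM modules give triangles (`extClosed_stableProp`), induction puts a d-th syzygy of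
every module of [C]_r into ⟨G⟩_r (`ball_le_iterate_cosyz`). On CM modules syzygies can be undone by
suspension, so every CM module lies in ⟨G⟩_{n+1}.

Conversely, a triangle X → Y → Z comes from an exact sequence 0 → X → Y ⊕ I → Z → 0 with I
projective, and a stable retract is a retract of modules after adding a projective. Hence ⟨G⟩_r lies
in [G]_r as soon as good classes are closed under suspension: a CM module T with a first syzygy in a
good class B must lie in B (`radius_le_stableDim`). For a hypersurface this is Eisenbud's
periodicity. Over S/(f) with f ≠ 0, the completion of T has a free resolution of length one over S
(`free_of_depthGE`), and multiplication by f turns it into a two-periodic resolution over S/(f). So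
the completed T is a retract of its second syzygy plus a free module. The retraction descends to R
by approximating maps modulo the maximal ideal (`exists_retract_of_tensorProduct`). Since B contains
ΩT, it contains Ω²T and therefore T. If f = 0, the completed T is already free. -/

/-- The short complex attached to a short exact sequence of linear maps. -/
abbrev sesComplex {X Y Z : ModuleCat.{u} R} (f : X →ₗ[R] Y) (g : Y →ₗ[R] Z)
    (h : Function.Exact f g) : ShortComplex (ModuleCat.{u} R) :=
  ModuleCat.shortComplexOfCompEqZero f g h.linearMap_comp_eq_zero

lemma sesComplex_shortExact {X Y Z : ModuleCat.{u} R} {f : X →ₗ[R] Y} {g : Y →ₗ[R] Z}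
    (hf : Function.Injective f) (h : Function.Exact f g) (hg : Function.Surjective g) :
    (sesComplex f g h).ShortExact :=
  ModuleCat.shortComplex_shortExact _ h hf hg

lemma subsingleton_ext_covariant₂ {X Y Z : ModuleCat.{u} R} {f : X →ₗ[R] Y} {g : Y →ₗ[R] Z}
    (hf : Function.Injective f) (h : Function.Exact f g) (hg : Function.Surjective g)
    (A : ModuleCat.{u} R) (i : ℕ) (h₁ : Subsingleton (Ext A X i)) (h₃ : Subsingleton (Ext A Z i)) :
    Subsingleton (Ext A Y i) := by
  refine subsingleton_of_forall_eq 0 fun y => ?_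
  obtain ⟨x, rfl⟩ := Ext.covariant_sequence_exact₂ A (sesComplex_shortExact hf h hg) y
    (h₃.elim _ _)
  rw [h₁.elim x 0, Ext.zero_comp]

lemma subsingleton_ext_covariant₁ {X Y Z : ModuleCat.{u} R} {f : X →ₗ[R] Y} {g : Y →ₗ[R] Z}
    (hf : Function.Injective f) (h : Function.Exact f g) (hg : Function.Surjective g)
    (A : ModuleCat.{u} R) (i : ℕ) (h₂ : Subsingleton (Ext A Y (i + 1)))
    (h₃ : Subsingleton (Ext A Z i)) :
    Subsingleton (Ext A X (i + 1)) := by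
  refine subsingleton_of_forall_eq 0 fun y => ?_
  obtain ⟨x, rfl⟩ := Ext.covariant_sequence_exact₁ A (sesComplex_shortExact hf h hg) y
    (h₂.elim _ _) rfl
  rw [h₃.elim x 0, Ext.zero_comp]

lemma subsingleton_ext_zero_of_injective {X Y : ModuleCat.{u} R} {f : X →ₗ[R] Y}
    (hf : Function.Injective f) (A : ModuleCat.{u} R) (h₂ : Subsingleton (Ext A Y 0)) :
    Subsingleton (Ext A X 0) := by
  have : Mono (ModuleCat.ofHom f) := (ModuleCat.mono_iff_injective _).2 hf
  exact (Ext.postcomp_mk₀_injective_of_mono A (ModuleCat.ofHom f)).subsingleton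

lemma subsingleton_ext_of_retract {X Y : ModuleCat.{u} R} (f : X →ₗ[R] Y) (g : Y →ₗ[R] X)
    (hfg : g ∘ₗ f = LinearMap.id)
    (A : ModuleCat.{u} R) (i : ℕ) (h₂ : Subsingleton (Ext A Y i)) :
    Subsingleton (Ext A X i) := by
  refine subsingleton_of_forall_eq 0 fun x => ?_
  have e : ModuleCat.ofHom f ≫ ModuleCat.ofHom g = 𝟙 X := by
    rw [← ModuleCat.ofHom_comp, hfg]; rfl
  have : (x.comp (Ext.mk₀ (ModuleCat.ofHom f)) (add_zero i)).comp
      (Ext.mk₀ (ModuleCat.ofHom g)) (add_zero i) = x := by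
    rw [Ext.comp_assoc_of_third_deg_zero, Ext.mk₀_comp_mk₀, e, Ext.comp_mk₀_id]
  rw [← this, h₂.elim (x.comp (Ext.mk₀ (ModuleCat.ofHom f)) (add_zero i)) 0, Ext.zero_comp]

variable [IsLocalRing R]

/-- The depth of `M` is at least `n`, in terms of the groups `Ext` from the residue field. -/
def DepthGE (n : ℕ) (M : ModuleCat.{u} R) : Prop :=
  ∀ i < n, Subsingleton (Ext (ModuleCat.of R (R ⧸ maximalIdeal R)) M i)

lemma DepthGE.mono {m n : ℕ} (hmn : m ≤ n) {M : ModuleCat.{u} R} (h : DepthGE n M) :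
    DepthGE m M :=
  fun i hi => h i (hi.trans_le hmn)

lemma DepthGE.of_retract {n : ℕ} {X Y : ModuleCat.{u} R} (h : DepthGE n Y) (f : X →ₗ[R] Y)
    (g : Y →ₗ[R] X) (hfg : g ∘ₗ f = LinearMap.id) : DepthGE n X :=
  fun i hi => subsingleton_ext_of_retract f g hfg _ i (h i hi)

lemma DepthGE.of_exact {n : ℕ} {X Y Z : ModuleCat.{u} R} {f : X →ₗ[R] Y} {g : Y →ₗ[R] Z}
    (hf : Function.Injective f) (h : Function.Exact f g) (hg : Function.Surjective g)
    (hX : DepthGE n X) (hZ : DepthGE n Z) : DepthGE n Y :=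
  fun i hi => subsingleton_ext_covariant₂ hf h hg _ i (hX i hi) (hZ i hi)

lemma DepthGE.of_exact_left {n : ℕ} {X Y Z : ModuleCat.{u} R} {f : X →ₗ[R] Y} {g : Y →ₗ[R] Z}
    (hf : Function.Injective f) (h : Function.Exact f g) (hg : Function.Surjective g)
    (hY : DepthGE (n + 1) Y) (hZ : DepthGE n Z) : DepthGE (n + 1) X := by
  rintro (_ | i) hi
  · exact subsingleton_ext_zero_of_injective hf _ (hY 0 hi)
  · exact subsingleton_ext_covariant₁ hf h hg _ i (hY _ hi) (hZ i (by omega))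

lemma DepthGE.of_subsingleton (n : ℕ) (M : ModuleCat.{u} R) [Subsingleton M] : DepthGE n M := by
  intro i _
  refine subsingleton_of_forall_eq 0 fun x => ?_
  rw [← Ext.comp_mk₀_id x, show 𝟙 M = 0 from (ModuleCat.isZero_of_subsingleton M).eq_of_src _ _,
    Ext.mk₀_zero, Ext.comp_zero]

variable [IsNoetherianRing R]

/-- Rees' characterization of depth: the residue field has the closed point as its support, so its
Ext groups detect regular sequences in the maximal ideal. The zero module is treated apart because
the regular-sequence criterion needs 𝔪M ≠ M. -/
lemma depthGE_iff (n : ℕ) (M : ModuleCat.{u} R) [Module.Finite R M] :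
    DepthGE n M ↔ ∃ rs : List R, rs.length = n ∧ (∀ r ∈ rs, r ∈ maximalIdeal R) ∧
      IsWeaklyRegular M rs := by
  rcases subsingleton_or_nontrivial M with hM | hM
  · refine iff_of_true (.of_subsingleton n M) ⟨List.replicate n 0, by simp, ?_, ?_⟩
    · intro r hr
      rw [List.eq_of_mem_replicate hr]
      exact zero_mem _
    · rw [isWeaklyRegular_iff]
      intro i hi x y _
      have : Subsingleton (M ⧸ (Ideal.ofList (List.take i (List.replicate n (0 : R))) •
        (⊤ : Submodule R M))) := (Submodule.mkQ_surjective _).subsingleton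
      exact Subsingleton.elim _ _
  · have hlt : maximalIdeal R • (⊤ : Submodule R M) < ⊤ :=
      (Submodule.top_ne_ideal_smul_of_le_jacobson_annihilator
        (maximalIdeal_le_jacobson _)).symm.lt_top
    constructor
    · intro h
      obtain ⟨rs, h₁, h₂, h₃⟩ := ModuleCat.exists_isRegular_of_exists_subsingleton_ext
        (maximalIdeal R) n M hlt (ModuleCat.of R (R ⧸ maximalIdeal R))
        (by rw [Module.support_eq_zeroLocus, Ideal.annihilator_quotient]) h
      exact ⟨rs, h₁, h₂, h₃.1⟩
    · rintro ⟨rs, rfl, h₂, h₃⟩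
      exact ModuleCat.subsingleton_ext_of_exists_isRegular (maximalIdeal R)
        (ModuleCat.of R (R ⧸ maximalIdeal R))
        (by rw [Module.support_eq_zeroLocus, Ideal.annihilator_quotient]) M hlt rs h₂
        (.of_isWeaklyRegular_of_mem_maximalIdeal M h₂ h₃)

variable (R) in
/-- The Krull dimension of a Noetherian local ring, as a natural number. -/
def dimNat : ℕ := (ringKrullDim R).unbotD 0 |>.toNat

variable (R) in
lemma coe_dimNat : ((dimNat R : ℕ) : WithBot ℕ∞) = ringKrullDim R := by
  obtain ⟨n, hn⟩ : ∃ n : ℕ, ringKrullDim R = n := by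
    have h₁ : ringKrullDim R ≠ ⊥ := ringKrullDim_ne_bot
    have h₂ : ringKrullDim R ≠ ⊤ := ringKrullDim_ne_top
    generalize ringKrullDim R = d at h₁ h₂
    induction d with
    | bot => exact absurd rfl h₁
    | coe d =>
      induction d with
      | top => exact absurd rfl h₂
      | coe n => exact ⟨n, rfl⟩
  rw [dimNat, hn]
  rfl

lemma length_le_dimNat {M : ModuleCat.{u} R} [Module.Finite R M] [Nontrivial M] {rs : List R}
    (h : ∀ r ∈ rs, r ∈ maximalIdeal R) (hr : IsWeaklyRegular M rs) : rs.length ≤ dimNat R := by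
  have h₁ := Module.supportDim_add_length_eq_supportDim_of_isRegular rs
    (IsRegular.of_isWeaklyRegular_of_mem_maximalIdeal M h hr)
  have h₂ := Module.supportDim_le_ringKrullDim R M
  have hn := (IsRegular.of_isWeaklyRegular_of_mem_maximalIdeal M h hr).quot_ofList_smul_nontrivial ⊤
  have h₃ := Module.supportDim_ne_bot_of_nontrivial R (M ⧸ Ideal.ofList rs • (⊤ : Submodule R M))
  rw [← h₁, ← coe_dimNat] at h₂
  generalize Module.supportDim R (M ⧸ Ideal.ofList rs • (⊤ : Submodule R M)) = d at h₂ h₃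
  induction d with
  | bot => exact absurd rfl h₃
  | coe d =>
    have : d + (rs.length : ℕ∞) ≤ (dimNat R : ℕ∞) := by exact_mod_cast h₂
    exact_mod_cast le_add_self.trans this

/-- For M ≠ 0 each regular element lowers the dimension of the support by one, so depth never
exceeds dim R and the equality is only a lower bound. Vanishing of Ext is the form that passes
through exact sequences. -/
lemma isCM_iff (M : ModuleCat.{u} R) :
    isCM R M ↔ Module.Finite R M ∧ DepthGE (dimNat R) M := by
  refine and_congr_right fun hM => ?_
  rcases subsingleton_or_nontrivial M with h | hn
  · exact iff_of_true (.inl h) (.of_subsingleton _ M)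
  · rw [or_iff_right (not_subsingleton M), ← coe_dimNat]
    have hle : depth R M ≤ dimNat R := by
      refine iSup_le fun rs => iSup_le fun h₁ => iSup_le fun h₂ => ?_
      exact_mod_cast length_le_dimNat h₁ h₂
    have key : (((depth R M : ℕ∞) : WithBot ℕ∞) = (dimNat R : ℕ)) ↔ (dimNat R : ℕ∞) ≤ depth R M := by
      rw [show ((dimNat R : ℕ) : WithBot ℕ∞) = ((dimNat R : ℕ∞) : WithBot ℕ∞) from rfl,
        WithBot.coe_inj]
      exact ⟨fun h => h.ge, fun h => le_antisymm hle h⟩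
    rw [key, depthGE_iff]
    constructor
    · intro h
      by_contra hcon
      have hlt : ∀ rs : List R, (∀ r ∈ rs, r ∈ maximalIdeal R) → IsWeaklyRegular M rs →
          rs.length < dimNat R := by
        intro rs h₁ h₂
        refine lt_of_le_of_ne (length_le_dimNat h₁ h₂) fun h₃ => hcon ⟨rs, h₃, h₁, h₂⟩
      -- The empty sequence already forces dim R > 0, so the truncated subtraction below is genuine.
      have hpos : 0 < dimNat R := (Nat.zero_le _).trans_lt (hlt [] (by simp) (by simp))
      have : depth R M ≤ (dimNat R - 1 : ℕ) := by
        refine iSup_le fun rs => iSup_le fun h₁ => iSup_le fun h₂ => ?_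
        have := hlt rs h₁ h₂
        exact_mod_cast (by omega : rs.length ≤ dimNat R - 1)
      have := h.trans this
      have : dimNat R ≤ dimNat R - 1 := by exact_mod_cast this
      omega
    · rintro ⟨rs, h₁, h₂, h₃⟩
      rw [← h₁]
      exact le_iSup_of_le rs (le_iSup_of_le h₂ (le_iSup_of_le h₃ le_rfl))

end Depth

end CMRadius
namespace CMRadius

open IsLocalRing RingTheory.Sequence CategoryTheory.Abelian

/-! ### Supports of Ext modules along chains of primes -/

section Support

variable {R : Type u} [CommRing R]

/-- The middle of the long exact Ext sequence, localized at q by hand: membership in the support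
means that some element is killed by nothing outside q, so no comparison of Ext with localization is
needed. -/
lemma support_ext_subset_of_exact {X Y Z : ModuleCat.{u} R} {f : X →ₗ[R] Y} {g : Y →ₗ[R] Z}
    (hf : Function.Injective f) (h : Function.Exact f g) (hg : Function.Surjective g)
    (N : ModuleCat.{u} R) (i : ℕ) :
    Module.support R (Ext Y N i) ⊆ Module.support R (Ext X N i) ∪ Module.support R (Ext Z N i) := by
  intro q hq
  by_contra hcon
  rw [Set.mem_union, not_or, Module.notMem_support_iff', Module.notMem_support_iff'] at hcon
  obtain ⟨y, hy⟩ := Module.mem_support_iff'.1 hq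
  obtain ⟨r, hr, hrx⟩ := hcon.1 ((Ext.mk₀ (ModuleCat.ofHom f)).comp y (zero_add i))
  obtain ⟨z, hz⟩ := Ext.contravariant_sequence_exact₂ (sesComplex_shortExact hf h hg) N (r • y)
    (by rw [Ext.comp_smul]; exact hrx)
  obtain ⟨s, hs, hsz⟩ := hcon.2 z
  refine hy (s * r) (fun hm => (q.2.mem_or_mem hm).elim hs hr) ?_
  rw [mul_smul, ← hz, ← Ext.comp_smul, hsz, Ext.comp_zero]

lemma support_ext_subset_of_equiv {X Y : ModuleCat.{u} R} (e : X ≃ₗ[R] Y)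
    (N : ModuleCat.{u} R) (i : ℕ) :
    Module.support R (Ext X N i) ⊆ Module.support R (Ext Y N i) := by
  have h := support_ext_subset_of_exact (X := X) (Y := Y) (Z := ModuleCat.of R PUnit.{u + 1})
    (f := e.toLinearMap) (g := 0) e.injective ((e.toLinearMap.exact_zero_iff_surjective _).2
    e.surjective) (Function.surjective_to_subsingleton _)
  have h' := support_ext_subset_of_exact (X := ModuleCat.of R PUnit.{u + 1}) (Y := X) (Z := Y)
    (f := 0) (g := e.toLinearMap) (Function.injective_of_subsingleton _)
    ((LinearMap.exact_zero_iff_injective _ _).2 e.injective) e.surjective N i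
  have h0 : Subsingleton (Ext (ModuleCat.of R PUnit.{u + 1}) N i) := by
    refine subsingleton_of_forall_eq 0 fun x => ?_
    rw [← Ext.mk₀_id_comp x, show 𝟙 (ModuleCat.of R PUnit.{u + 1}) = 0 from
      (ModuleCat.isZero_of_subsingleton _).eq_of_src _ _, Ext.mk₀_zero, Ext.zero_comp]
  rwa [Module.support_eq_empty (M := Ext (ModuleCat.of R PUnit.{u + 1}) N i),
    Set.empty_union] at h'

variable [IsNoetherianRing R]

/-- The connecting map of 0 → M → M → M/xM → 0 embeds Ext^i(M, N)/x into Ext^{i+1}(M/xM, N). As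
Ext^i(M, N) is finitely generated and x ∈ q, Nakayama keeps q in the support of that quotient. -/
lemma mem_support_ext_quotSMulTop {M N : ModuleCat.{u} R} [Module.Finite R M] [Module.Finite R N]
    {x : R} (hx : IsSMulRegular M x) {q : PrimeSpectrum R} (hxq : x ∈ q.asIdeal) {i : ℕ}
    (hq : q ∈ Module.support R (Ext M N i)) :
    q ∈ Module.support R (Ext (ModuleCat.of R (QuotSMulTop x M)) N (i + 1)) := by
  have hq' : q ∈ Module.support R (QuotSMulTop x (Ext M N i)) := by
    rw [Module.support_quotSMulTop]
    exact ⟨hq, by simpa using hxq⟩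
  obtain ⟨e, he⟩ := Module.mem_support_iff'.1 hq'
  obtain ⟨e, rfl⟩ := Submodule.mkQ_surjective _ e
  rw [Module.mem_support_iff']
  refine ⟨hx.smulShortComplex_shortExact.extClass.comp e (add_comm 1 i), fun r hr h0 => he r hr ?_⟩
  obtain ⟨e', he'⟩ : ∃ e' : Ext M N i, (Ext.mk₀ (x • 𝟙 M)).comp e' (zero_add i) = r • e :=
    Ext.contravariant_sequence_exact₁ hx.smulShortComplex_shortExact N (r • e)
      (add_comm 1 i) ((Ext.comp_smul _ _ _ _).trans h0)
  rw [← map_smul, ← he', Ext.mk₀_smul, Ext.smul_comp, Ext.mk₀_id_comp, Submodule.mkQ_apply, Submodule.Quotient.mk_eq_zero]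
  exact Submodule.smul_mem_pointwise_smul _ _ _ trivial

omit [IsNoetherianRing R] in
lemma annihilator_le_annihilator_ext (M N : ModuleCat.{u} R) (i : ℕ) :
    Module.annihilator R M ≤ Module.annihilator R (Ext M N i) := by
  intro r hr
  rw [Module.mem_annihilator] at hr ⊢
  intro e
  have : r • 𝟙 M = 0 := by
    ext x
    exact hr x
  rw [← Ext.mk₀_id_comp (r • e), Ext.comp_smul, ← Ext.smul_comp, ← Ext.mk₀_smul, this,
    Ext.mk₀_zero, Ext.zero_comp]

/-- If `q` lies in the support of `Ext^j(M, N)`, then it lies in the support of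
`Ext^j'(R / q, N)` for some `j' ≥ j`. -/
lemma exists_mem_support_ext_quotient_prime (N : ModuleCat.{u} R) [Module.Finite R N]
    (q : PrimeSpectrum R) (M : ModuleCat.{u} R) [Module.Finite R M] (j : ℕ)
    (hq : q ∈ Module.support R (Ext M N j)) :
    ∃ j' ≥ j, q ∈ Module.support R (Ext (ModuleCat.of R (R ⧸ q.asIdeal)) N j') := by
  -- Noetherian induction on an ideal I killing M, with a prime filtration inside. A factor R/p with
  -- p strictly below q is divided by some x ∈ q outside p: this raises the degree by one and
  -- enlarges the annihilator to contain p + (x), where the induction hypothesis applies.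
  suffices H : ∀ (I : Ideal R) (M : Type u) [AddCommGroup M] [Module R M] (_ : Module.Finite R M),
      I ≤ Module.annihilator R M → ∀ j : ℕ,
      q ∈ Module.support R (Ext (ModuleCat.of R M) N j) →
      ∃ j' ≥ j, q ∈ Module.support R (Ext (ModuleCat.of R (R ⧸ q.asIdeal)) N j') from
    H ⊥ M inferInstance bot_le j hq
  clear hq j
  intro I
  induction I using WellFoundedGT.induction with
  | ind I ih =>
  intro M _ _ hM
  induction hM using IsNoetherianRing.induction_on_isQuotientEquivQuotientPrime R with
  | subsingleton L =>
    intro _ j hj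
    exfalso
    have : Module.annihilator R L ≤ q.asIdeal :=
      (annihilator_le_annihilator_ext (ModuleCat.of R L) N j).trans
        (Module.annihilator_le_of_mem_support hj)
    rw [Module.annihilator_eq_top_iff.2 inferInstance] at this
    exact q.2.ne_top (top_le_iff.1 this)
  | quotient L p e =>
    intro hI j hj
    have hann : Module.annihilator R L = p.asIdeal := by
      rw [e.annihilator_eq, Ideal.annihilator_quotient]
    rw [hann] at hI
    have hpq : p ≤ q := by
      rw [← PrimeSpectrum.asIdeal_le_asIdeal, ← hann]
      exact (annihilator_le_annihilator_ext (ModuleCat.of R L) N j).trans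
        (Module.annihilator_le_of_mem_support hj)
    rcases hpq.eq_or_lt with rfl | hlt
    · exact ⟨j, le_rfl, support_ext_subset_of_equiv (X := ModuleCat.of R L)
        (Y := ModuleCat.of R (R ⧸ p.asIdeal)) e N j hj⟩
    · obtain ⟨x, hxq, hxp⟩ := SetLike.exists_of_lt (show p.asIdeal < q.asIdeal from hlt)
      have hreg : IsSMulRegular (ModuleCat.of R L) x := by
        change IsSMulRegular L x
        rw [e.isSMulRegular_congr]
        intro a b hab
        obtain ⟨a, rfl⟩ := Ideal.Quotient.mk_surjective a
        obtain ⟨b, rfl⟩ := Ideal.Quotient.mk_surjective b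
        have hab' : Ideal.Quotient.mk p.asIdeal (x * a) = Ideal.Quotient.mk p.asIdeal (x * b) := hab
        rw [Ideal.Quotient.eq, ← mul_sub] at hab'
        exact Ideal.Quotient.eq.2 ((p.2.mem_or_mem hab').resolve_left hxp)
      obtain ⟨j', h₁, h₂⟩ := ih (p.asIdeal ⊔ Ideal.span {x}) (lt_of_le_of_lt hI (by
          refine lt_of_le_of_ne le_sup_left fun h => hxp ?_
          rw [h]
          exact Ideal.mem_sup_right (Ideal.mem_span_singleton_self x)))
        (QuotSMulTop x L) inferInstance (sup_le (by
          rw [← hann]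
          exact LinearMap.annihilator_le_of_surjective _ (Submodule.mkQ_surjective _)) (by
          rw [Ideal.span_singleton_le_iff_mem, Module.mem_annihilator]
          intro m
          obtain ⟨m, rfl⟩ := Submodule.mkQ_surjective _ m
          rw [← map_smul, Submodule.mkQ_apply, Submodule.Quotient.mk_eq_zero]
          exact Submodule.smul_mem_pointwise_smul _ _ _ trivial)) (j + 1)
        (mem_support_ext_quotSMulTop hreg hxq hj)
      exact ⟨j', by omega, h₂⟩
  | exact N₁ N₂ N₃ f g hf hg hfg h₁ h₃ =>
    intro hI j hj
    rcases support_ext_subset_of_exact (X := ModuleCat.of R N₁) (Y := ModuleCat.of R N₂)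
      (Z := ModuleCat.of R N₃) (f := f) (g := g) hf hfg hg N j hj with h | h
    · exact h₁ (hI.trans (LinearMap.annihilator_le_of_injective f hf)) j h
    · exact h₃ (hI.trans (LinearMap.annihilator_le_of_surjective g hg)) j h

/-- The non-vanishing of `Ext` is passed on along chains of prime ideals. -/
lemma exists_mem_support_ext_of_lt (N : ModuleCat.{u} R) [Module.Finite R N]
    {p q : PrimeSpectrum R} (hpq : p < q) {i : ℕ}
    (hp : p ∈ Module.support R (Ext (ModuleCat.of R (R ⧸ p.asIdeal)) N i)) :
    ∃ j ≥ i + 1, q ∈ Module.support R (Ext (ModuleCat.of R (R ⧸ q.asIdeal)) N j) := by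
  obtain ⟨x, hxq, hxp⟩ := SetLike.exists_of_lt (show p.asIdeal < q.asIdeal from hpq)
  have hreg : IsSMulRegular (ModuleCat.of R (R ⧸ p.asIdeal)) x := by
    intro a b hab
    obtain ⟨a, rfl⟩ := Ideal.Quotient.mk_surjective a
    obtain ⟨b, rfl⟩ := Ideal.Quotient.mk_surjective b
    have hab' : Ideal.Quotient.mk p.asIdeal (x * a) = Ideal.Quotient.mk p.asIdeal (x * b) := hab
    rw [Ideal.Quotient.eq, ← mul_sub] at hab'
    exact Ideal.Quotient.eq.2 ((p.2.mem_or_mem hab').resolve_left hxp)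
  exact exists_mem_support_ext_quotient_prime N q _ _
    (mem_support_ext_quotSMulTop hreg hxq (Module.mem_support_mono hpq.le hp))

/-- Each strict inclusion of primes raises the degree by at least one; the start is the identity of
R, whose annihilator is zero. -/
lemma exists_mem_support_ext_last (s : LTSeries (PrimeSpectrum R)) :
    ∃ i ≥ s.length, s.last ∈ Module.support R
      (Ext (ModuleCat.of R (R ⧸ s.last.asIdeal)) (ModuleCat.of R R) i) := by
  induction s using RelSeries.inductionOn' with
  | singleton p =>
    have : p ∈ Module.support R (Ext (ModuleCat.of R R) (ModuleCat.of R R) 0) := by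
      rw [Module.mem_support_iff']
      refine ⟨Ext.mk₀ (𝟙 _), fun r hr h => hr ?_⟩
      rw [← Ext.mk₀_smul, Ext.mk₀_eq_zero_iff] at h
      have h' := congrArg (fun φ : ModuleCat.of R R ⟶ ModuleCat.of R R => φ.hom (1 : R)) h
      have h'' : r * 1 = 0 := h'
      rw [mul_one] at h''
      rw [h'']
      exact zero_mem _
    obtain ⟨j, hj, hj'⟩ := exists_mem_support_ext_quotient_prime _ p _ _ this
    exact ⟨j, hj, hj'⟩
  | snoc s p hp ih =>
    obtain ⟨i, hi, hi'⟩ := ih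
    obtain ⟨j, hj, hj'⟩ := exists_mem_support_ext_of_lt _ hp hi'
    refine ⟨j, ?_, ?_⟩
    · simp only [RelSeries.snoc_length]
      omega
    · rw [RelSeries.last_snoc]
      exact hj'

end Support

lemma nontrivial_of_mem_support {R M : Type*} [CommRing R] [AddCommGroup M] [Module R M]
    {p : PrimeSpectrum R} (h : p ∈ Module.support R M) : Nontrivial M :=
  Module.nonempty_support_iff.1 ⟨p, h⟩

/-! ### A Gorenstein local ring is Cohen–Macaulay -/

section Gorenstein

variable (R : Type u) [CommRing R]

lemma exists_nontrivial_ext_residueField [IsLocalRing R] [IsNoetherianRing R] :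
    ∃ i ≥ dimNat R,
      Nontrivial (Ext.{u} (ModuleCat.of R (R ⧸ maximalIdeal R)) (ModuleCat.of R R) i) := by
  obtain ⟨s, hs⟩ : ∃ s : LTSeries (PrimeSpectrum R), s.length = dimNat R := by
    have h : ((dimNat R : ℕ) : WithBot ℕ∞) ≤ Order.krullDim (PrimeSpectrum R) := (coe_dimNat R).le
    exact Order.le_krullDim_iff.1 h
  obtain ⟨i, hi, hi'⟩ := exists_mem_support_ext_last s
  have hle : s.last ≤ closedPoint R := IsLocalRing.le_maximalIdeal s.last.2.ne_top
  obtain ⟨j, hj, hj'⟩ := exists_mem_support_ext_quotient_prime (ModuleCat.of R R)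
    (closedPoint R) _ _ (Module.mem_support_mono hle hi')
  have := nontrivial_of_mem_support hj'
  exact ⟨j, by omega, this⟩

/-- Let r be the top degree with Ext^r(k, R) ≠ 0. Then r ≥ dim R by the chain argument, and depth R
≥ r: if R had depth t < r, the quotient Q by a maximal regular sequence would contain k and have
projective dimension t. Then Ext^r(k, R) would sit between Ext^r(Q, R) = 0 and Ext^{r+1}(Q/k, R) =
0. -/
lemma depthGE_dimNat_of_isGorensteinLocalRing [IsGorensteinLocalRing R] :
    DepthGE (dimNat R) (ModuleCat.of R R) := by
  classical
  obtain ⟨n, hn⟩ := IsGorensteinLocalRing.exists_hasInjectiveDimensionLE (R := R)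
  let k := ModuleCat.of R (R ⧸ maximalIdeal R)
  obtain ⟨i₀, hi₀, hi₀'⟩ := exists_nontrivial_ext_residueField R
  have hbound : ∀ i, Nontrivial (Ext.{u} k (ModuleCat.of R R) i) → i ≤ n := by
    intro i hi
    by_contra hlt
    have := HasInjectiveDimensionLT.subsingleton (ModuleCat.of R R) (n + 1) i (by omega) k
    exact not_subsingleton _ this
  obtain ⟨r, hr, hmax⟩ : ∃ r, Nontrivial (Ext.{u} k (ModuleCat.of R R) r) ∧
      ∀ i, Nontrivial (Ext.{u} k (ModuleCat.of R R) i) → i ≤ r :=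
    ⟨Nat.findGreatest (fun i => Nontrivial (Ext.{u} k (ModuleCat.of R R) i)) n,
      Nat.findGreatest_spec (P := fun i => Nontrivial (Ext.{u} k (ModuleCat.of R R) i))
        (hbound _ hi₀') hi₀',
      fun i hi => Nat.le_findGreatest (hbound i hi) hi⟩
  -- Nonvanishing for any finite module propagates to the closed point in a degree at least as
  -- large, so r bounds all finite modules at once.
  have hvanish : ∀ (M : ModuleCat.{u} R) [Module.Finite R M] (j : ℕ), r < j →
      Subsingleton (Ext.{u} M (ModuleCat.of R R) j) := by
    intro M _ j hj
    by_contra hcon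
    rw [not_subsingleton_iff_nontrivial] at hcon
    obtain ⟨p, hp⟩ := Module.nonempty_support_iff (R := R).2 hcon
    have hle : p ≤ closedPoint R := IsLocalRing.le_maximalIdeal p.2.ne_top
    obtain ⟨j', h₁, h₂⟩ := exists_mem_support_ext_quotient_prime (ModuleCat.of R R)
      (closedPoint R) _ _ (Module.mem_support_mono hle hp)
    have h₃ := nontrivial_of_mem_support h₂
    have := hmax j' h₃
    omega
  suffices h : DepthGE r (ModuleCat.of R R) from h.mono (hi₀.trans (hmax _ hi₀'))
  by_contra hcon
  obtain ⟨t, htr, ht, ht'⟩ : ∃ t < r, DepthGE t (ModuleCat.of R R) ∧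
      ¬ DepthGE (t + 1) (ModuleCat.of R R) := by
    by_contra hall
    push Not at hall
    refine hcon ?_
    have : ∀ t ≤ r, DepthGE t (ModuleCat.of R R) := by
      intro t
      induction t with
      | zero => exact fun _ i hi => absurd hi (by omega)
      | succ t ih => exact fun h => hall t h (ih (by omega))
    exact this r le_rfl
  obtain ⟨xs, hlen, hmem, hreg⟩ := (depthGE_iff _ _).1 ht
  let Q := ModuleCat.of R (R ⧸ (Ideal.ofList xs • ⊤ : Submodule R R))
  -- If Hom(k, Q) were zero, Q would have a regular element and the sequence `xs` could be prolonged
  -- to length t + 1.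
  have hk : ¬ Subsingleton (Ext k Q 0) := by
    intro hsub
    have hD : DepthGE 1 Q := fun i hi => by
      obtain rfl : i = 0 := by omega
      exact hsub
    obtain ⟨ys, h₁, h₂, h₃⟩ := (depthGE_iff 1 Q).1 hD
    refine ht' ((depthGE_iff _ _).2 ⟨xs ++ ys, by simp [hlen, h₁], ?_, ?_⟩)
    · intro a ha
      exact (List.mem_append.1 ha).elim (hmem a) (h₂ a)
    · exact (isWeaklyRegular_append_iff _ _ _).2 ⟨hreg, h₃⟩
  obtain ⟨φ, hφ⟩ : ∃ φ : k →ₗ[R] Q, φ ≠ 0 := by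
    by_contra hall
    push Not at hall
    exact hk ((Ext.addEquiv₀.trans ModuleCat.homAddEquiv).subsingleton_congr.2
      (subsingleton_of_forall_eq 0 hall))
  have hinj : Function.Injective φ := by
    have : IsSimpleModule R k :=
      isSimpleModule_iff_quot_maximal.2 ⟨_, inferInstance, ⟨LinearEquiv.refl R _⟩⟩
    exact (LinearMap.injective_or_eq_zero φ).resolve_right hφ
  have hpd : HasProjectiveDimensionLE Q t := by
    have hpd := ModuleCat.projectiveDimension_quotient_eq_add_length_of_isWeaklyRegular (ModuleCat.of R R) xs
      hreg hmem
    rw [← projectiveDimension_le_iff]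
    refine hpd.le.trans ?_
    rw [hlen]
    have h0 : projectiveDimension (ModuleCat.of R R) ≤ (0 : ℕ) := by
      rw [projectiveDimension_le_iff]
      have : Projective (ModuleCat.of R R) :=
        (IsProjective.iff_projective R).1 inferInstance
      exact inferInstanceAs (HasProjectiveDimensionLT _ 1)
    calc _ ≤ ((0 : ℕ) : WithBot ℕ∞) + (t : WithBot ℕ∞) := by gcongr
      _ = t := by simp
  have h₁ : Subsingleton (Ext Q (ModuleCat.of R R) r) :=
    HasProjectiveDimensionLT.subsingleton Q (t + 1) r (by omega) _
  have hses := sesComplex_shortExact (X := k) (Y := Q)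
    (Z := ModuleCat.of R (Q ⧸ LinearMap.range φ)) (f := φ)
    (g := (LinearMap.range φ).mkQ) hinj (LinearMap.exact_map_mkQ_range φ)
    (Submodule.mkQ_surjective _)
  have h₂ : Subsingleton (Ext (ModuleCat.of R (Q ⧸ LinearMap.range φ)) (ModuleCat.of R R) (1 + r)) :=
    hvanish _ _ (by omega)
  refine not_subsingleton (Ext k (ModuleCat.of R R) r) (subsingleton_of_forall_eq 0 fun x => ?_)
  obtain ⟨y, rfl⟩ := Ext.contravariant_sequence_exact₁ hses _ x rfl (h₂.elim _ _)
  rw [h₁.elim y 0, Ext.comp_zero]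

end Gorenstein

end CMRadius
namespace CMRadius

/-! ### Comparing syzygies of a module and of its retracts -/

section Lifting

variable {R : Type*} [Ring R] {N F Y N' F' X M : Type*}
  [AddCommGroup N] [Module R N] [AddCommGroup F] [Module R F] [AddCommGroup Y] [Module R Y]
  [AddCommGroup N'] [Module R N'] [AddCommGroup F'] [Module R F'] [AddCommGroup X] [Module R X]
  [AddCommGroup M] [Module R M]

lemma exists_lift_of_exact {i : N →ₗ[R] F} {p : F →ₗ[R] Y} (hi : Function.Injective i)
    (h : Function.Exact i p) (φ : M →ₗ[R] F) (hφ : p ∘ₗ φ = 0) :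
    ∃ ψ : M →ₗ[R] N, i ∘ₗ ψ = φ := by
  have hmem : ∀ m, φ m ∈ LinearMap.range i := fun m => (h (φ m)).1 (LinearMap.congr_fun hφ m)
  refine ⟨(LinearEquiv.ofInjective i hi).symm.toLinearMap ∘ₗ φ.codRestrict _ hmem, ?_⟩
  ext m
  exact congrArg Subtype.val ((LinearEquiv.ofInjective i hi).apply_symm_apply ⟨φ m, hmem m⟩)

/-- A syzygy of a retract of `Y` is a retract of a syzygy of `Y`, up to a projective summand. -/
lemma exists_retract_of_syzygy [Module.Projective R F] [Module.Projective R F']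
    {i : N →ₗ[R] F} {p : F →ₗ[R] Y} (hi : Function.Injective i) (h : Function.Exact i p)
    (hp : Function.Surjective p) {i' : N' →ₗ[R] F'} {p' : F' →ₗ[R] X}
    (hi' : Function.Injective i') (h' : Function.Exact i' p') (hp' : Function.Surjective p')
    (a : X →ₗ[R] Y) (b : Y →ₗ[R] X) (hab : b ∘ₗ a = LinearMap.id) :
    ∃ (f : N' →ₗ[R] N × F') (g : N × F' →ₗ[R] N'), g ∘ₗ f = LinearMap.id := by
  obtain ⟨α, hα⟩ := Module.projective_lifting_property p (a ∘ₗ p') hp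
  obtain ⟨β, hβ⟩ := Module.projective_lifting_property p' (b ∘ₗ p) hp'
  have e : ∀ x, p' (i' x) = 0 := h'.apply_apply_eq_zero
  have e₂ : ∀ x, p (i x) = 0 := h.apply_apply_eq_zero
  have hα' : ∀ x, p (α x) = a (p' x) := LinearMap.congr_fun hα
  have hβ' : ∀ x, p' (β x) = b (p x) := LinearMap.congr_fun hβ
  have hab' : ∀ x, b (a x) = x := LinearMap.congr_fun hab
  obtain ⟨α', h₁⟩ := exists_lift_of_exact hi h (α ∘ₗ i') (by ext x; simp [hα', e])
  obtain ⟨β', h₂⟩ := exists_lift_of_exact hi' h' (β ∘ₗ i) (by ext x; simp [hβ', e₂])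
  -- The lifted composite β ∘ α induces the identity on X, so its defect has image in the syzygy.
  -- This defect is what the projective summand F' repairs.
  obtain ⟨γ, h₃⟩ := exists_lift_of_exact hi' h' (LinearMap.id - β ∘ₗ α)
    (by ext x; simp [hβ', hα', hab'])
  refine ⟨α'.prod i', β'.coprod γ, LinearMap.ext fun x => hi' ?_⟩
  have h₁' : ∀ x, i (α' x) = α (i' x) := LinearMap.congr_fun h₁
  have h₂' : ∀ x, i' (β' x) = β (i x) := LinearMap.congr_fun h₂
  have h₃' : ∀ x, i' (γ x) = x - β (α x) := LinearMap.congr_fun h₃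
  simp [h₂', h₁', h₃']

end Lifting

/-! ### Good classes of modules and their cosyzygy classes -/

section Good

variable {R : Type u} [CommRing R]

/-- Classes of finitely generated modules which contain `R` and are closed under retracts, finite
direct sums and syzygies. -/
structure IsGood (Q : ObjectProperty (ModuleCat.{u} R)) : Prop where
  finite {X : ModuleCat.{u} R} : Q X → Module.Finite R X
  retract {X Y : ModuleCat.{u} R} (f : X →ₗ[R] Y) (g : Y →ₗ[R] X) :
    g ∘ₗ f = LinearMap.id → Q Y → Q X
  prod {X Y : ModuleCat.{u} R} : Q X → Q Y → Q (ModuleCat.of R (X × Y))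
  self : Q (ModuleCat.of R R)
  syzygy {X Y : ModuleCat.{u} R} {n : ℕ} (i : X →ₗ[R] (Fin n → R)) (p : (Fin n → R) →ₗ[R] Y) :
    Function.Injective i → Function.Exact i p → Function.Surjective p → Q Y → Q X

namespace IsGood

variable {Q : ObjectProperty (ModuleCat.{u} R)} (hQ : IsGood Q)

include hQ

lemma of_equiv {X Y : ModuleCat.{u} R} (e : X ≃ₗ[R] Y) (h : Q Y) : Q X :=
  hQ.retract e.toLinearMap e.symm.toLinearMap (by ext x; simp) h

lemma of_subsingleton {X : ModuleCat.{u} R} (h : Subsingleton X) : Q X :=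
  hQ.retract (Y := ModuleCat.of R R) 0 0 (by ext x; exact Subsingleton.elim _ _) hQ.self

lemma pi {n : ℕ} (X : Fin n → ModuleCat.{u} R) (h : ∀ i, Q (X i)) :
    Q (ModuleCat.of R (∀ i, X i)) := by
  induction n with
  | zero => exact hQ.of_subsingleton (inferInstanceAs (Subsingleton (∀ i, X i)))
  | succ n ih =>
    exact hQ.of_equiv (Y := ModuleCat.of R (X 0 × ModuleCat.of R (∀ i : Fin n, X i.succ)))
      (Fin.consLinearEquiv R (fun i => X i)).symm
      (hQ.prod (h 0) (ih (fun i => X i.succ) fun i => h _))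

lemma free (n : ℕ) : Q (ModuleCat.of R (Fin n → R)) :=
  hQ.pi (fun _ => ModuleCat.of R R) fun _ => hQ.self

lemma projective (P : ModuleCat.{u} R) [Module.Finite R P] [Module.Projective R P] : Q P := by
  obtain ⟨n, f, hf⟩ := Module.Finite.exists_fin' R P
  obtain ⟨g, hg⟩ := Module.projective_lifting_property f LinearMap.id hf
  exact hQ.retract (Y := ModuleCat.of R (Fin n → R)) g f hg (hQ.free n)

end IsGood

lemma exists_presentation (M : ModuleCat.{u} R) [Module.Finite R M] :
    ∃ (n : ℕ) (N : ModuleCat.{u} R) (i : N →ₗ[R] (Fin n → R)) (p : (Fin n → R) →ₗ[R] M),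
      Function.Injective i ∧ Function.Exact i p ∧ Function.Surjective p := by
  obtain ⟨n, p, hp⟩ := Module.Finite.exists_fin' R M
  exact ⟨n, ModuleCat.of R (LinearMap.ker p), (LinearMap.ker p).subtype, p,
    Subtype.val_injective, LinearMap.exact_subtype_ker_map p, hp⟩

lemma IsGood.syzygy_of_projective {Q : ObjectProperty (ModuleCat.{u} R)} (hQ : IsGood Q)
    {X F Y : ModuleCat.{u} R} [Module.Finite R F] [Module.Projective R F]
    {i : X →ₗ[R] F} {p : F →ₗ[R] Y} (hi : Function.Injective i) (h : Function.Exact i p)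
    (hp : Function.Surjective p) (hY : Q Y) : Q X := by
  have := hQ.finite hY
  obtain ⟨n, N, i', p', hi', h', hp'⟩ := exists_presentation Y
  obtain ⟨f, g, hfg⟩ := exists_retract_of_syzygy hi' h' hp' hi h hp LinearMap.id LinearMap.id rfl
  exact hQ.retract (Y := ModuleCat.of R (N × F)) f g hfg
    (hQ.prod (hQ.syzygy i' p' hi' h' hp' hY) (hQ.projective F))

/-- The modules with a first syzygy in `Q`. -/
def cosyz (Q : ObjectProperty (ModuleCat.{u} R)) : ObjectProperty (ModuleCat.{u} R) := fun M =>
  ∃ (n : ℕ) (N : ModuleCat.{u} R) (i : N →ₗ[R] (Fin n → R)) (p : (Fin n → R) →ₗ[R] M),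
    Function.Injective i ∧ Function.Exact i p ∧ Function.Surjective p ∧ Q N

/-- Schanuel: the kernels of two presentations are retracts of each other up to projective summands,
so the existential in `cosyz` may be tested on any single presentation. -/
lemma IsGood.cosyz_iff {Q : ObjectProperty (ModuleCat.{u} R)} (hQ : IsGood Q)
    {X F Y : ModuleCat.{u} R} [Module.Finite R F] [Module.Projective R F]
    {i : X →ₗ[R] F} {p : F →ₗ[R] Y} (hi : Function.Injective i) (h : Function.Exact i p)
    (hp : Function.Surjective p) : cosyz Q Y ↔ Q X := by
  constructor
  · rintro ⟨n, N, i', p', hi', h', hp', hN⟩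
    obtain ⟨f, g, hfg⟩ := exists_retract_of_syzygy hi' h' hp' hi h hp LinearMap.id LinearMap.id rfl
    exact hQ.retract (Y := ModuleCat.of R (N × F)) f g hfg (hQ.prod hN (hQ.projective F))
  · intro hX
    have : Module.Finite R Y := Module.Finite.of_surjective p hp
    obtain ⟨n, N, i', p', hi', h', hp'⟩ := exists_presentation Y
    obtain ⟨f, g, hfg⟩ := exists_retract_of_syzygy hi h hp hi' h' hp' LinearMap.id LinearMap.id rfl
    exact ⟨n, N, i', p', hi', h', hp', hQ.retract (Y := ModuleCat.of R (X × (Fin n → R))) f g hfg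
      (hQ.prod hX (hQ.free n))⟩

lemma cosyz_finite {Q : ObjectProperty (ModuleCat.{u} R)} {M : ModuleCat.{u} R}
    (h : cosyz Q M) : Module.Finite R M := by
  obtain ⟨n, N, i, p, -, -, hp, -⟩ := h
  exact Module.Finite.of_surjective p hp

lemma isGood_cosyz [IsNoetherianRing R] {Q : ObjectProperty (ModuleCat.{u} R)} (hQ : IsGood Q) :
    IsGood (cosyz Q) where
  finite := cosyz_finite
  retract {X Y} a b hab hY := by
    obtain ⟨n, N, i, p, hi, h, hp, hN⟩ := hY
    have := Module.Finite.of_surjective p hp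
    have : Module.Finite R X :=
      Module.Finite.of_surjective b (fun x => ⟨a x, LinearMap.congr_fun hab x⟩)
    obtain ⟨m, N', i', p', hi', h', hp'⟩ := exists_presentation X
    obtain ⟨f, g, hfg⟩ := exists_retract_of_syzygy hi h hp hi' h' hp' a b hab
    exact ⟨m, N', i', p', hi', h', hp', hQ.retract (Y := ModuleCat.of R (N × (Fin m → R))) f g hfg
      (hQ.prod hN (hQ.free m))⟩
  prod {X Y} hX hY := by
    obtain ⟨n, N, i, p, hi, h, hp, hN⟩ := hX
    obtain ⟨n', N', i', p', hi', h', hp', hN'⟩ := hY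
    exact (hQ.cosyz_iff (F := ModuleCat.of R ((Fin n → R) × (Fin n' → R)))
      (X := ModuleCat.of R (N × N')) (Y := ModuleCat.of R (X × Y)) (i := i.prodMap i')
      (p := p.prodMap p') (hi.prodMap hi') (fun ⟨x, y⟩ => by
        have h₁ := h x
        have h₂ := h' y
        simp only [LinearMap.prodMap_apply, Prod.mk_eq_zero, Set.mem_range, Prod.exists,
          Prod.mk.injEq] at h₁ h₂ ⊢
        rw [h₁, h₂]
        exact ⟨fun ⟨⟨a, ha⟩, ⟨b, hb⟩⟩ => ⟨a, b, ha, hb⟩,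
          fun ⟨a, b, ha, hb⟩ => ⟨⟨a, ha⟩, ⟨b, hb⟩⟩⟩) (hp.prodMap hp')).2 (hQ.prod hN hN')
  self := (hQ.cosyz_iff (X := ModuleCat.of R PUnit.{u + 1}) (F := ModuleCat.of R R)
    (Y := ModuleCat.of R R) (i := 0) (p := LinearMap.id) (Function.injective_of_subsingleton _)
    ((LinearMap.exact_zero_iff_injective _ _).2 Function.injective_id)
    Function.surjective_id).2 (hQ.of_subsingleton (inferInstanceAs (Subsingleton PUnit)))
  syzygy {X Y n} i p hi h hp hY := by
    have hX : Q X := (hQ.cosyz_iff (F := ModuleCat.of R (Fin n → R)) hi h hp).1 hY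
    have := hQ.finite hX
    obtain ⟨m, N, i', p', hi', h', hp'⟩ := exists_presentation X
    exact ⟨m, N, i', p', hi', h', hp', hQ.syzygy i' p' hi' h' hp' hX⟩

/-- Extensions of modules in `Q₂` by modules in `Q₁` are in `Q₃`. -/
def ExtClosed (Q₁ Q₂ Q₃ : ObjectProperty (ModuleCat.{u} R)) : Prop :=
  circ Q₁ Q₂ ≤ Q₃

/-- Horseshoe lemma: presentations of X and Y combine to one of M, whose kernel is an extension of
the two kernels. -/
lemma extClosed_cosyz {Q₁ Q₂ Q₃ : ObjectProperty (ModuleCat.{u} R)} (hQ₃ : IsGood Q₃)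
    (H : ExtClosed Q₁ Q₂ Q₃) : ExtClosed (cosyz Q₁) (cosyz Q₂) (cosyz Q₃) := by
  rintro M ⟨X, Y, f, g, ⟨n, N, i, p, hi, h, hp, hN⟩, ⟨n', N', i', p', hi', h', hp', hN'⟩,
    hf, hfg, hg⟩
  obtain ⟨l, hl⟩ := Module.projective_lifting_property g p' hg
  have hl' : ∀ x, g (l x) = p' x := LinearMap.congr_fun hl
  have hgf : ∀ x, g (f x) = 0 := hfg.apply_apply_eq_zero
  let q : ((Fin n → R) × (Fin n' → R)) →ₗ[R] M := (f ∘ₗ p).coprod l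
  have hq : ∀ x y, q (x, y) = f (p x) + l y := fun _ _ => rfl
  have hq_surj : Function.Surjective q := by
    intro m
    obtain ⟨y, hy⟩ := hp' (g m)
    obtain ⟨x, hx⟩ := (hfg (m - l y)).1 (by rw [map_sub, hl', hy, sub_self])
    obtain ⟨x, rfl⟩ := hp x
    exact ⟨(x, y), by rw [hq, hx]; abel⟩
  refine (hQ₃.cosyz_iff (X := ModuleCat.of R (LinearMap.ker q))
    (F := ModuleCat.of R ((Fin n → R) × (Fin n' → R))) (i := (LinearMap.ker q).subtype) (p := q)
    Subtype.val_injective (LinearMap.exact_subtype_ker_map q) hq_surj).2 ?_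
  have hpi : ∀ x, p (i x) = 0 := h.apply_apply_eq_zero
  have hpi' : ∀ x, p' (i' x) = 0 := h'.apply_apply_eq_zero
  let u : N →ₗ[R] LinearMap.ker q := (LinearMap.inl R _ _ ∘ₗ i).codRestrict _ fun x => by
    simp [LinearMap.mem_ker, hq, hpi]
  obtain ⟨v, hv⟩ := exists_lift_of_exact hi' h'
    (LinearMap.snd R (Fin n → R) (Fin n' → R) ∘ₗ (LinearMap.ker q).subtype) (by
      ext ⟨⟨x, y⟩, hxy⟩
      have hxy' : f (p x) + l y = 0 := hxy
      have : g (f (p x) + l y) = 0 := by rw [hxy', map_zero]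
      rw [map_add, hgf, hl', zero_add] at this
      simpa using this)
  have hv' : ∀ x, i' (v x) = x.1.2 := LinearMap.congr_fun hv
  refine H _ ⟨N, N', u, v, hN, hN', ?_, ?_, ?_⟩
  · intro x y hxy
    exact hi (congrArg (fun z => z.1.1) hxy)
  · rintro ⟨⟨x, y⟩, hxy⟩
    have hxy' : f (p x) + l y = 0 := hxy
    constructor
    · intro hz
      have hy : y = 0 := by
        have := hv' ⟨(x, y), hxy⟩
        rw [hz, map_zero] at this
        exact this.symm
      subst hy
      have hx : p x = 0 := hf (by simpa using hxy')
      obtain ⟨a, rfl⟩ := (h x).1 hx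
      exact ⟨a, rfl⟩
    · rintro ⟨a, ha⟩
      refine hi' ?_
      rw [hv', map_zero]
      exact (congrArg (fun z => z.1.2) ha).symm
  · intro y
    obtain ⟨x, hx⟩ := (hfg (-l (i' y))).1 (by rw [map_neg, hl', hpi', neg_zero])
    obtain ⟨x, rfl⟩ := hp x
    refine ⟨⟨(x, i' y), ?_⟩, hi' (hv' _)⟩
    rw [LinearMap.mem_ker, hq, hx, neg_add_cancel]

end Good

/-! ### Brackets and balls as good classes -/

section Bracket

open IsLocalRing

variable {R : Type u} [CommRing R] [IsLocalRing R]

lemma IsGood.isSyzygy {Q : ObjectProperty (ModuleCat.{u} R)} (hQ : IsGood Q) {k : ℕ}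
    {N M : ModuleCat.{u} R} (h : IsSyzygy k N M) (hM : Q M) : Q N := by
  induction k generalizing N with
  | zero => exact hQ.of_equiv h.some hM
  | succ k ih =>
    obtain ⟨L, hL, n, i, p, hi, hip, hp, -⟩ := h
    exact hQ.syzygy i p hi hip hp (ih hL)

lemma IsGood.bracket_le {P Q : ObjectProperty (ModuleCat.{u} R)} (hQ : IsGood Q) (hPQ : P ≤ Q) :
    bracket P ≤ Q := by
  rintro M ⟨n, X, N, hX, ⟨e⟩⟩
  refine hQ.retract (Y := ModuleCat.of R (∀ i, X i)) (e.toLinearMap ∘ₗ LinearMap.inl R M N)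
    (LinearMap.fst R M N ∘ₗ e.symm.toLinearMap) (by ext x; simp) (hQ.pi X fun i => ?_)
  rcases hX i with ⟨⟨e⟩⟩ | ⟨k, Y, hY, hk⟩
  · exact hQ.of_equiv (Y := ModuleCat.of R R) e hQ.self
  · exact hQ.isSyzygy hk (hPQ _ hY)

/-- Take a surjection from a free module of least rank. A relation with a unit coefficient would
make the corresponding generator superfluous, so the kernel lies in 𝔪Rⁿ. -/
lemma exists_isFirstSyzygy (M : ModuleCat.{u} R) [Module.Finite R M] :
    ∃ N : ModuleCat.{u} R, IsFirstSyzygy N M := by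
  classical
  have hex : ∃ n : ℕ, ∃ p : (Fin n → R) →ₗ[R] M, Function.Surjective p :=
    Module.Finite.exists_fin' R M
  obtain ⟨p, hp⟩ := Nat.find_spec hex
  have hmin := fun m => Nat.find_min hex (m := m)
  generalize Nat.find hex = n at p hp hmin
  refine ⟨ModuleCat.of R (LinearMap.ker p), n, (LinearMap.ker p).subtype, p,
    Subtype.val_injective, LinearMap.exact_subtype_ker_map p, hp, ?_⟩
  rw [Submodule.range_subtype]
  intro v hv
  have hmem : ∀ j, v j ∈ maximalIdeal R := by
    by_contra! hj
    obtain ⟨j, hj⟩ := hj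
    obtain ⟨w, hw⟩ : IsUnit (v j) := by simpa using hj
    cases n with
    | zero => exact j.elim0
    | succ n =>
    -- The composed map inserts 0 at position j; subtracting the multiple x_j w⁻¹ v of the relation
    -- v clears the j-th coordinate of x without changing its image.
    refine hmin n (Nat.lt_succ_self n) ⟨p ∘ₗ
      (LinearMap.pi fun k => if h : ∃ l, j.succAbove l = k then LinearMap.proj h.choose else 0), ?_⟩
    intro m
    obtain ⟨x, rfl⟩ := hp m
    refine ⟨fun l => x (j.succAbove l) - x j * ↑w⁻¹ * v (j.succAbove l), ?_⟩
    have : p x = p (x - (x j * ↑w⁻¹) • v) := by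
      rw [map_sub, map_smul, LinearMap.mem_ker.1 hv, smul_zero, sub_zero]
    rw [this, LinearMap.comp_apply]
    congr 1
    ext k
    rw [LinearMap.pi_apply]
    by_cases hk : ∃ l, j.succAbove l = k
    · rw [dif_pos hk, LinearMap.proj_apply, hk.choose_spec]
      rfl
    · rw [dif_neg hk]
      have hkj : k = j := by
        by_contra hne
        exact hk (Fin.exists_succAbove_eq hne)
      subst hkj
      simp [← hw, mul_assoc]
  have : v = ∑ j, v j • (Pi.single j 1 : Fin n → R) := by
    ext k
    simp [Finset.sum_apply, Pi.single_apply]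
  rw [this]
  exact Submodule.sum_mem _ fun j _ => Submodule.smul_mem_smul (hmem j) trivial

omit [IsLocalRing R] in
lemma addClosure_prod {P : ObjectProperty (ModuleCat.{u} R)} {X Y : ModuleCat.{u} R}
    (hX : addClosure P X) (hY : addClosure P Y) : addClosure P (ModuleCat.of R (X × Y)) := by
  obtain ⟨n, A, N, hA, ⟨e⟩⟩ := hX
  obtain ⟨m, B, L, hB, ⟨e'⟩⟩ := hY
  let C : Fin n ⊕ Fin m → ModuleCat.{u} R := Sum.elim A B
  have hC : ∀ s, P (C s) := by
    rintro (i | i)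
    exacts [hA i, hB i]
  refine ⟨n + m, fun i => C (finSumFinEquiv.symm i), ModuleCat.of R (N × L), fun i => hC _, ⟨?_⟩⟩
  refine LinearEquiv.prodProdProdComm R X Y N L ≪≫ₗ e.prodCongr e' ≪≫ₗ ?_ ≪≫ₗ
    LinearEquiv.piCongrLeft' R (fun s => C s) finSumFinEquiv
  exact (LinearEquiv.sumPiEquivProdPi R (Fin n) (Fin m) (fun s => C s)).symm

omit [IsLocalRing R] in
lemma addClosure_retract {P : ObjectProperty (ModuleCat.{u} R)} {X Y : ModuleCat.{u} R}
    (f : X →ₗ[R] Y) (g : Y →ₗ[R] X) (hfg : g ∘ₗ f = LinearMap.id) (hY : addClosure P Y) :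
    addClosure P X := by
  obtain ⟨n, A, N, hA, ⟨e⟩⟩ := hY
  have hfg' : ∀ x, g (f x) = x := LinearMap.congr_fun hfg
  let e' : (X × LinearMap.ker g) ≃ₗ[R] Y := LinearEquiv.ofLinearMap
    (f.coprod (LinearMap.ker g).subtype)
    (g.prod ((LinearMap.id - f ∘ₗ g).codRestrict _ fun y => by simp [hfg']))
    (by ext y; simp) (by
      ext x
      · simp [hfg']
      · simp [hfg']
      · simp
      · simp)
  exact ⟨n, A, ModuleCat.of R (LinearMap.ker g × N), hA,
    ⟨(LinearEquiv.prodAssoc R X (LinearMap.ker g) N).symm ≪≫ₗ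
      e'.prodCongr (LinearEquiv.refl R N) ≪≫ₗ e⟩⟩

omit [IsLocalRing R] in
lemma addClosure_of {P : ObjectProperty (ModuleCat.{u} R)} {X : ModuleCat.{u} R} (hX : P X) :
    addClosure P X :=
  ⟨1, fun _ => X, ModuleCat.of R PUnit.{u + 1}, fun _ => hX,
    ⟨LinearEquiv.prodUnique ≪≫ₗ (LinearEquiv.funUnique (Fin 1) R X).symm⟩⟩

lemma le_bracket (P : ObjectProperty (ModuleCat.{u} R)) : P ≤ bracket P := fun X hX =>
  addClosure_of (.inr ⟨0, X, hX, ⟨LinearEquiv.refl R X⟩⟩)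

/-- Only closure under syzygies needs an argument: a generator Ωⁱ Z has the first syzygy Ωⁱ⁺¹ Z, R
has the syzygy 0, and a syzygy of a summand is a retract of a syzygy of the sum plus a free module.
-/
lemma bracket_isGood [IsNoetherianRing R] {P : ObjectProperty (ModuleCat.{u} R)}
    (hP : ∀ X, P X → Module.Finite R X) : IsGood (bracket P) := by
  have hsyz : ∀ {k : ℕ} {N M : ModuleCat.{u} R}, Module.Finite R M → IsSyzygy k N M →
      Module.Finite R N := by
    intro k N M hM h
    cases k with
    | zero => exact Module.Finite.equiv h.some.symm
    | succ k =>
      obtain ⟨L, -, n, i, -, hi, -⟩ := h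
      exact Module.Finite.of_injective i hi
  have hfin : ∀ {M : ModuleCat.{u} R}, (Nonempty (M ≃ₗ[R] R) ∨
      ∃ (i : ℕ) (X : ModuleCat.{u} R), P X ∧ IsSyzygy i M X) → Module.Finite R M := by
    rintro M (⟨⟨e⟩⟩ | ⟨k, X, hX, h⟩)
    · exact Module.Finite.equiv e.symm
    · exact hsyz (hP X hX) h
  have hfin' : ∀ {M : ModuleCat.{u} R}, bracket P M → Module.Finite R M := by
    rintro M ⟨n, X, N, hX, ⟨e⟩⟩
    have := fun i => hfin (hX i)
    exact Module.Finite.of_surjective (LinearMap.fst R M N ∘ₗ e.symm.toLinearMap)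
      ((LinearMap.fst_surjective (R := R) (M := M) (M₂ := N)).comp e.symm.surjective)
  have hself : bracket P (ModuleCat.of R R) := addClosure_of (.inl ⟨LinearEquiv.refl R R⟩)
  have hpi : ∀ {n : ℕ} (X : Fin n → ModuleCat.{u} R), (∀ i, bracket P (X i)) →
      bracket P (ModuleCat.of R (∀ i, X i)) := by
    intro n X h
    induction n with
    | zero =>
      exact addClosure_retract (Y := ModuleCat.of R R) 0 0 (by
        ext j : 1; exact j.elim0) hself
    | succ n ih =>
      exact addClosure_retract
        (Y := ModuleCat.of R (X 0 × ModuleCat.of R (∀ i : Fin n, X i.succ)))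
        (Fin.consLinearEquiv R (fun i => X i)).symm.toLinearMap
        (Fin.consLinearEquiv R (fun i => X i)).toLinearMap (by ext x; simp)
        (addClosure_prod (h 0) (ih (fun i => X i.succ) fun i => h _))
  refine ⟨hfin', addClosure_retract, addClosure_prod, hself, ?_⟩
  rintro X Y n i p hi h hp ⟨m, A, N, hA, ⟨e⟩⟩
  have hA' : ∀ j, ∃ (k : ℕ) (B : ModuleCat.{u} R) (i : B →ₗ[R] (Fin k → R))
      (p : (Fin k → R) →ₗ[R] A j), Function.Injective i ∧ Function.Exact i p ∧
        Function.Surjective p ∧ bracket P B := by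
    intro j
    rcases hA j with ⟨⟨e⟩⟩ | ⟨k, Z, hZ, hk⟩
    · let e' : (Fin 1 → R) ≃ₗ[R] A j := LinearEquiv.funUnique (Fin 1) R R ≪≫ₗ e.symm
      exact ⟨1, ModuleCat.of R PUnit.{u + 1}, 0, e'.toLinearMap,
        Function.injective_of_subsingleton _,
        (LinearMap.exact_zero_iff_injective _ _).2 e'.injective, e'.surjective,
        addClosure_retract (Y := ModuleCat.of R R) 0 0 (by ext x) hself⟩
    · have := hsyz (hP Z hZ) hk
      obtain ⟨B, hB⟩ := exists_isFirstSyzygy (A j)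
      have hB' := hB
      obtain ⟨l, i, p, hi, h, hp, -⟩ := hB'
      exact ⟨l, B, i, p, hi, h, hp, addClosure_of (.inr ⟨k + 1, Z, hZ, A j, hk, hB⟩)⟩
  choose k B ι π hι hιπ hπ hB using hA'
  obtain ⟨f, g, hfg⟩ := exists_retract_of_syzygy (N := ∀ j, B j) (F := ∀ j, Fin (k j) → R)
    (Y := ∀ j, A j) (i := LinearMap.piMap ι) (p := LinearMap.piMap π)
    (Function.Injective.piMap hι) (fun x => by
      constructor
      · intro hx
        choose y hy using fun j => (hιπ j (x j)).1 (congrFun hx j)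
        exact ⟨y, funext hy⟩
      · rintro ⟨y, rfl⟩
        exact funext fun j => (hιπ j).apply_apply_eq_zero (y j)) (Function.Surjective.piMap hπ)
    hi h hp (e.toLinearMap ∘ₗ LinearMap.inl R Y N) (LinearMap.fst R Y N ∘ₗ e.symm.toLinearMap)
    (by ext x; simp)
  refine addClosure_retract (Y := ModuleCat.of R ((∀ j, B j) × (Fin n → R))) f g hfg ?_
  exact addClosure_prod (X := ModuleCat.of R (∀ j, B j)) (Y := ModuleCat.of R (Fin n → R))
    (hpi B hB) (hpi (fun _ => ModuleCat.of R R) fun _ => hself)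

lemma ball_isGood [IsNoetherianRing R] {P : ObjectProperty (ModuleCat.{u} R)}
    (hP : ∀ X, P X → Module.Finite R X) (r : ℕ) : IsGood (ball P (r + 1)) := by
  induction r with
  | zero => exact bracket_isGood hP
  | succ r ih =>
    refine bracket_isGood ?_
    rintro M ⟨X, Y, f, g, hX, hY, hf, h, hg⟩
    have := (bracket_isGood hP).finite hY
    have := ih.finite (ih.bracket_le le_rfl _ hX)
    have := Module.Finite.equiv (h.linearEquivOfSurjective hg).symm
    exact Module.Finite.of_submodule_quotient (LinearMap.range f)

end Bracket

end CMRadius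
namespace CMRadius

open IsLocalRing

/-! ### Closure properties of Cohen–Macaulay modules -/

section CM

variable {R : Type u} [CommRing R] [IsLocalRing R] [IsNoetherianRing R]

lemma isCM_of_retract {X Y : ModuleCat.{u} R} (f : X →ₗ[R] Y) (g : Y →ₗ[R] X)
    (hfg : g ∘ₗ f = LinearMap.id) (hY : isCM R Y) : isCM R X := by
  rw [isCM_iff] at hY ⊢
  have := hY.1
  exact ⟨Module.Finite.of_surjective g fun x => ⟨f x, LinearMap.congr_fun hfg x⟩,
    hY.2.of_retract f g hfg⟩

lemma isCM_of_exact {X Y Z : ModuleCat.{u} R} {f : X →ₗ[R] Y} {g : Y →ₗ[R] Z}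
    (hf : Function.Injective f) (h : Function.Exact f g) (hg : Function.Surjective g)
    (hX : isCM R X) (hZ : isCM R Z) : isCM R Y := by
  rw [isCM_iff] at hX hZ ⊢
  have := hX.1
  have := hZ.1
  have := Module.Finite.equiv (h.linearEquivOfSurjective hg).symm
  exact ⟨Module.Finite.of_submodule_quotient (LinearMap.range f),
    .of_exact hf h hg hX.2 hZ.2⟩

lemma isCM_prod {X Y : ModuleCat.{u} R} (hX : isCM R X) (hY : isCM R Y) :
    isCM R (ModuleCat.of R (X × Y)) :=
  isCM_of_exact (f := LinearMap.inl R X Y) (g := LinearMap.snd R X Y) LinearMap.inl_injective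
    Function.Exact.inl_snd LinearMap.snd_surjective hX hY

lemma isCM_of_exact_left {X Y Z : ModuleCat.{u} R} {f : X →ₗ[R] Y} {g : Y →ₗ[R] Z}
    (hf : Function.Injective f) (h : Function.Exact f g) (hg : Function.Surjective g)
    (hY : isCM R Y) (hZ : isCM R Z) : isCM R X := by
  rw [isCM_iff] at hY hZ ⊢
  have := hY.1
  refine ⟨Module.Finite.of_injective f hf, ?_⟩
  have h₁ := hY.2
  have h₂ := hZ.2
  generalize dimNat R = d at h₁ h₂
  cases d with
  | zero => exact fun i hi => absurd hi (by omega)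
  | succ d => exact .of_exact_left hf h hg h₁ (h₂.mono (Nat.le_succ d))

end CM

/-! ### From linear maps and exact sequences to the stable category -/

section StableHom

variable {R : Type u} [CommRing R] [IsLocalRing R]

/-- The morphism of the stable category given by a linear map. -/
def stHom {M N : CMCat R} (f : M.obj →ₗ[R] N.obj) : (toStable R).obj M ⟶ (toStable R).obj N :=
  (toStable R).map (ObjectProperty.homMk (ModuleCat.ofHom f))

lemma stHom_comp {M N L : CMCat R} (f : M.obj →ₗ[R] N.obj) (g : N.obj →ₗ[R] L.obj) :
    stHom f ≫ stHom g = stHom (M := M) (N := L) (g ∘ₗ f) := by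
  rw [stHom, stHom, ← Functor.map_comp]
  rfl

lemma stHom_id (M : CMCat R) : stHom (M := M) (N := M) LinearMap.id = 𝟙 _ :=
  (toStable R).map_id M

lemma stHom_add {M N : CMCat R} (f g : M.obj →ₗ[R] N.obj) :
    stHom (M := M) (N := N) (f + g) = stHom f + stHom g :=
  rfl

lemma stHom_surjective {M N : CMCat R} (φ : (toStable R).obj M ⟶ (toStable R).obj N) :
    ∃ f : M.obj →ₗ[R] N.obj, stHom f = φ := by
  obtain ⟨f, rfl⟩ := (toStable R).map_surjective φ
  exact ⟨f.hom.hom, rfl⟩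

lemma stHom_eq_iff {M N : CMCat R} (f g : M.obj →ₗ[R] N.obj) :
    stHom (M := M) (N := N) f = stHom g ↔
      FactorsThroughProjective (ModuleCat.ofHom f - ModuleCat.ofHom g) :=
  Quotient.functor_map_eq_iff (stableRel R) _ _

/-- Retracts of modules are retracts in the stable category. -/
def stRetract {M N : CMCat R} (f : M.obj →ₗ[R] N.obj) (g : N.obj →ₗ[R] M.obj)
    (hfg : g ∘ₗ f = LinearMap.id) : Retract ((toStable R).obj M) ((toStable R).obj N) where
  i := stHom f
  r := stHom g
  retract := by rw [stHom_comp, hfg, stHom_id]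

lemma isZero_toStable {M : CMCat R} [Module.Finite R M.obj] [Module.Projective R M.obj] :
    IsZero ((toStable R).obj M) := by
  rw [IsZero.iff_id_eq_zero, ← stHom_id]
  refine (stHom_eq_iff (M := M) (N := M) LinearMap.id 0).2
    ⟨M.obj, inferInstance, inferInstance, 𝟙 _, 𝟙 _, ?_⟩
  ext x
  simp

/-- A short exact sequence of Cohen-Macaulay modules as a short complex in `CM(R)`. -/
def cmComplex {A B C : CMCat R} (f : A.obj →ₗ[R] B.obj) (g : B.obj →ₗ[R] C.obj)
    (h : Function.Exact f g) : ShortComplex (CMCat R) where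
  f := ObjectProperty.homMk (X := A) (Y := B) (ModuleCat.ofHom f)
  g := ObjectProperty.homMk (X := B) (Y := C) (ModuleCat.ofHom g)
  zero := by
    ext x
    exact h.apply_apply_eq_zero x

lemma isConflation_cmComplex {A B C : CMCat R} {f : A.obj →ₗ[R] B.obj} {g : B.obj →ₗ[R] C.obj}
    (hf : Function.Injective f) (h : Function.Exact f g) (hg : Function.Surjective g) :
    IsConflation (cmComplex f g h) :=
  sesComplex_shortExact hf h hg

lemma isSuspension_of_exact {A B C : CMCat R} [Module.Projective R B.obj]
    {f : A.obj →ₗ[R] B.obj} {g : B.obj →ₗ[R] C.obj}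
    (hf : Function.Injective f) (h : Function.Exact f g) (hg : Function.Surjective g) :
    IsSuspension ((toStable R).obj A) ((toStable R).obj C) :=
  ⟨cmComplex f g h, isConflation_cmComplex hf h hg, inferInstanceAs (Module.Projective R B.obj),
    ⟨Iso.refl _⟩, ⟨Iso.refl _⟩⟩

lemma generated_prod {P : ObjectProperty (StableCM R)} {X Y Z : CMCat R}
    (e : Z.obj ≃ₗ[R] (X.obj × Y.obj)) (hX : generated P ((toStable R).obj X))
    (hY : generated P ((toStable R).obj Y)) : generated P ((toStable R).obj Z) := by
  have zero {M N : CMCat R} : stHom (M := M) (N := N) 0 = 0 := rfl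
  let b : BinaryBicone ((toStable R).obj X) ((toStable R).obj Y) :=
    { pt := (toStable R).obj Z
      fst := stHom (LinearMap.fst R X.obj Y.obj ∘ₗ e.toLinearMap)
      snd := stHom (LinearMap.snd R X.obj Y.obj ∘ₗ e.toLinearMap)
      inl := stHom (e.symm.toLinearMap ∘ₗ LinearMap.inl R X.obj Y.obj)
      inr := stHom (e.symm.toLinearMap ∘ₗ LinearMap.inr R X.obj Y.obj)
      inl_fst := by
        rw [stHom_comp, ← stHom_id]; congr 1; ext x; simp
      inl_snd := by
        rw [stHom_comp, ← zero]; congr 1; ext x; simp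
      inr_fst := by
        rw [stHom_comp, ← zero]; congr 1; ext x; simp
      inr_snd := by
        rw [stHom_comp, ← stHom_id]; congr 1; ext x; simp }
  refine generated.sum hX hY b (isBinaryBilimitOfTotal b ?_)
  change stHom _ ≫ stHom _ + stHom _ ≫ stHom _ = 𝟙 ((toStable R).obj Z)
  rw [stHom_comp, stHom_comp, ← stHom_add, ← stHom_id]
  congr 1
  ext x
  apply e.injective
  simp

/-- Lets closure properties be proved once for `generated` and then used in every layer. -/
lemma generatedIn_succ (P : ObjectProperty (StableCM R)) (r : ℕ) :
    ∃ P', generatedIn P (r + 1) = generated P' := by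
  cases r with
  | zero => exact ⟨P, rfl⟩
  | succ r => exact ⟨_, rfl⟩

/-- The Cohen-Macaulay modules whose class in the stable category lies in `P`. -/
def stableProp (P : ObjectProperty (StableCM R)) : ObjectProperty (ModuleCat.{u} R) :=
  fun M => ∃ h : isCM R M, P ((toStable R).obj ⟨M, h⟩)

end StableHom

/-! ### The inequality dim ≤ radius -/

section Radius

variable {R : Type u} [CommRing R] [IsGorensteinLocalRing R]

variable (R) in
lemma isCM_self : isCM R (ModuleCat.of R R) :=
  (isCM_iff _).2 ⟨inferInstanceAs (Module.Finite R R), depthGE_dimNat_of_isGorensteinLocalRing R⟩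

lemma isCM_free (n : ℕ) : isCM R (ModuleCat.of R (Fin n → R)) := by
  induction n with
  | zero =>
    exact isCM_of_retract (X := ModuleCat.of R (Fin 0 → R)) (Y := ModuleCat.of R R) 0 0
      (by ext j; exact j.elim0) (isCM_self R)
  | succ n ih =>
    exact isCM_of_retract (X := ModuleCat.of R (Fin (n + 1) → R))
      (Y := ModuleCat.of R (R × (Fin n → R)))
      (Fin.consLinearEquiv R (fun _ => R)).symm.toLinearMap
      (Fin.consLinearEquiv R (fun _ => R)).toLinearMap (by ext x; simp)
      (isCM_prod (X := ModuleCat.of R R) (Y := ModuleCat.of R (Fin n → R)) (isCM_self R) ih)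

lemma isGood_isCM : IsGood (isCM R) where
  finite h := h.1
  retract f g hfg h := isCM_of_retract f g hfg h
  prod := isCM_prod
  self := isCM_self R
  syzygy {_ _ n} _ _ hi h hp hY :=
    isCM_of_exact_left (Y := ModuleCat.of R (Fin n → R)) hi h hp (isCM_free n) hY

lemma isGood_stableProp_generated (P : ObjectProperty (StableCM R)) :
    IsGood (stableProp (generated P)) where
  finite h := h.1.1
  retract {X Y} f g hfg := fun ⟨h, hY⟩ =>
    ⟨isCM_of_retract f g hfg h, hY.summand
      (stRetract (M := ⟨X, isCM_of_retract f g hfg h⟩) (N := ⟨Y, h⟩) f g hfg)⟩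
  prod {X Y} := fun ⟨h₁, hX⟩ ⟨h₂, hY⟩ =>
    ⟨isCM_prod h₁ h₂, generated_prod (Z := ⟨_, isCM_prod h₁ h₂⟩) (LinearEquiv.refl R _) hX hY⟩
  self := by
    have : Module.Projective R (ModuleCat.of R R) := inferInstanceAs (Module.Projective R R)
    have : Module.Finite R (ModuleCat.of R R) := inferInstanceAs (Module.Finite R R)
    exact ⟨isCM_self R, .zero (isZero_toStable (M := ⟨_, isCM_self R⟩))⟩
  syzygy {X Y n} i p hi h hp := fun ⟨h₁, hY⟩ =>
    have hX := isGood_isCM.syzygy i p hi h hp h₁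
    have : Module.Projective R (ModuleCat.of R (Fin n → R)) :=
      inferInstanceAs (Module.Projective R (Fin n → R))
    ⟨hX, .desuspension hY (isSuspension_of_exact (A := ⟨X, hX⟩) (B := ⟨_, isCM_free n⟩)
      (C := ⟨Y, h₁⟩) hi h hp)⟩

lemma isGood_stableProp (P : ObjectProperty (StableCM R)) (r : ℕ) :
    IsGood (stableProp (generatedIn P (r + 1))) := by
  obtain ⟨P', h⟩ := generatedIn_succ P r
  rw [h]
  exact isGood_stableProp_generated P'

/-- Once M is CM, the presentation is a conflation with free middle term, so M is the suspension of
its syzygy. -/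
lemma stableProp_of_cosyz {P : ObjectProperty (StableCM R)} {M : ModuleCat.{u} R}
    (hM : isCM R M) (h : cosyz (stableProp (generated P)) M) : stableProp (generated P) M := by
  obtain ⟨n, N, i, p, hi, hip, hp, hN, hN'⟩ := h
  have : Module.Projective R (ModuleCat.of R (Fin n → R)) :=
      inferInstanceAs (Module.Projective R (Fin n → R))
  exact ⟨hM, .suspension hN' (isSuspension_of_exact (A := ⟨N, hN⟩) (B := ⟨_, isCM_free n⟩)
      (C := ⟨M, hM⟩) hi hip hp)⟩

lemma stableProp_of_iterate_cosyz {P : ObjectProperty (StableCM R)} (n : ℕ) {M : ModuleCat.{u} R}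
    (hM : isCM R M) (h : cosyz^[n] (stableProp (generated P)) M) :
    stableProp (generated P) M := by
  induction n generalizing M with
  | zero => exact h
  | succ n ih =>
    rw [Function.iterate_succ', Function.comp_apply] at h
    obtain ⟨k, N, i, p, hi, hip, hp, hN⟩ := h
    exact stableProp_of_cosyz hM
      ⟨k, N, i, p, hi, hip, hp, ih (isGood_isCM.syzygy i p hi hip hp hM) hN⟩

/-- Each syzygy gains one in depth until dim R is reached. The quantifier over `Q` records that N is
an n-th syzygy of C, without naming the intermediate modules. -/
lemma exists_iterate_cosyz (n j : ℕ) (C : ModuleCat.{u} R) [Module.Finite R C]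
    (hC : DepthGE j C) (hj : j + n ≤ dimNat R) :
    ∃ N : ModuleCat.{u} R, Module.Finite R N ∧ DepthGE (j + n) N ∧
      ∀ Q : ObjectProperty (ModuleCat.{u} R), Q N → cosyz^[n] Q C := by
  induction n generalizing j C with
  | zero => exact ⟨C, inferInstance, hC, fun Q h => h⟩
  | succ n ih =>
    obtain ⟨k, N, i, p, hi, hip, hp⟩ := exists_presentation C
    have hN : Module.Finite R N := Module.Finite.of_injective i hi
    have hN' : DepthGE (j + 1) N := .of_exact_left (Y := ModuleCat.of R (Fin k → R)) hi hip hp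
      (((isCM_iff _).1 (isCM_free k)).2.mono (by omega)) hC
    obtain ⟨L, h₁, h₂, h₃⟩ := ih (j + 1) N hN' (by omega)
    refine ⟨L, h₁, h₂.mono (by omega), fun Q hQ => ?_⟩
    rw [Function.iterate_succ', Function.comp_apply]
    exact ⟨k, N, i, p, hi, hip, hp, h₃ Q hQ⟩

omit [IsGorensteinLocalRing R] in
/-- A short exact sequence `0 → X → Y → Z → 0` induces `0 → ΩZ → X ⊕ F → Y → 0` with `F` free. -/
lemma exists_rotate {X Y Z : ModuleCat.{u} R} [Module.Finite R Z]
    {f : X →ₗ[R] Y} {g : Y →ₗ[R] Z}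
    (hf : Function.Injective f) (h : Function.Exact f g) (hg : Function.Surjective g) :
    ∃ (n : ℕ) (K : ModuleCat.{u} R) (i : K →ₗ[R] (Fin n → R)) (p : (Fin n → R) →ₗ[R] Z)
      (a : K →ₗ[R] X × (Fin n → R)) (b : X × (Fin n → R) →ₗ[R] Y),
      Function.Injective i ∧ Function.Exact i p ∧ Function.Surjective p ∧
      Function.Injective a ∧ Function.Exact a b ∧ Function.Surjective b := by
  obtain ⟨n, p, hp⟩ := Module.Finite.exists_fin' R Z
  obtain ⟨l, hl⟩ := Module.projective_lifting_property g p hg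
  have hl' : ∀ x, g (l x) = p x := LinearMap.congr_fun hl
  have hgf : ∀ x, g (f x) = 0 := h.apply_apply_eq_zero
  let b : X × (Fin n → R) →ₗ[R] Y := f.coprod l
  have hb : ∀ x y, b (x, y) = f x + l y := fun _ _ => rfl
  -- Since f is injective, the second projection identifies ker b with ker p, so this one module
  -- serves as the syzygy of Z.
  refine ⟨n, ModuleCat.of R (LinearMap.ker b), LinearMap.snd R _ _ ∘ₗ (LinearMap.ker b).subtype,
    p, (LinearMap.ker b).subtype, b, ?_, ?_, hp, Subtype.val_injective,
    LinearMap.exact_subtype_ker_map b, ?_⟩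
  · rintro ⟨⟨x, y⟩, hxy⟩ ⟨⟨x', y'⟩, hxy'⟩ (rfl : y = y')
    have h₁ : f x + l y = 0 := hxy
    have h₂ : f x' + l y = 0 := hxy'
    obtain rfl : x = x' := hf (add_right_cancel (h₁.trans h₂.symm))
    rfl
  · intro y
    constructor
    · intro hy
      obtain ⟨x, hx⟩ := (h (-l y)).1 (by rw [map_neg, hl', hy, neg_zero])
      exact ⟨⟨(x, y), by rw [LinearMap.mem_ker, hb, hx, neg_add_cancel]⟩, rfl⟩
    · rintro ⟨⟨⟨x, y⟩, hxy⟩, rfl⟩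
      have h₁ : f x + l y = 0 := hxy
      have : g (f x + l y) = 0 := by rw [h₁, map_zero]
      rw [map_add, hgf, hl', zero_add] at this
      exact this
  · intro y
    obtain ⟨z, hz⟩ := hp (g y)
    obtain ⟨x, hx⟩ := (h (y - l z)).1 (by rw [map_sub, hl', hz, sub_self])
    exact ⟨(x, z), by rw [hb, hx, sub_add_cancel]⟩

/-- `IsDistinguished` asks for the middle object at the left of a pushout row, so the sequence is
rotated twice, to 0 → ΩY → ΩZ ⊕ F' → X ⊕ F → 0. Pushing out a presentation of X ⊕ F gives the
triangle ΩX → ΩY → ΩZ, and suspending its middle term returns Y. -/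
lemma extClosed_stableProp (P : ObjectProperty (StableCM R)) (r : ℕ) :
    ExtClosed (stableProp (generatedIn P (r + 1))) (stableProp (generatedIn P 1))
      (stableProp (generatedIn P (r + 2))) := by
  rintro Y ⟨X, Z, f, g, hX, hZ, hf, hfg, hg⟩
  have hr := isGood_stableProp P r
  have h1 := isGood_stableProp P 0
  have hYCM : isCM R Y := isCM_of_exact hf hfg hg hX.1 hZ.1
  have := hZ.1.1
  have := hYCM.1
  obtain ⟨n, K, i, p, a, b, hi, hip, hp, ha, hab, hb⟩ := exists_rotate hf hfg hg
  have hK := h1.syzygy i p hi hip hp hZ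
  obtain ⟨m, L, i', p', a', b', hi', hip', hp', ha', hab', hb'⟩ :=
    exists_rotate (Y := ModuleCat.of R (X × (Fin n → R))) ha hab hb
  have hLCM : isCM R L := isGood_isCM.syzygy i' p' hi' hip' hp' hYCM
  have hXn : stableProp (generatedIn P (r + 1)) (ModuleCat.of R (X × (Fin n → R))) :=
    hr.prod hX (hr.free n)
  have hKm : stableProp (generatedIn P 1) (ModuleCat.of R (K × (Fin m → R))) :=
    h1.prod hK (h1.free m)
  have := hXn.1.1
  obtain ⟨k, A, j, q, hj, hjq, hq⟩ := exists_presentation (ModuleCat.of R (X × (Fin n → R)))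
  have hA := hr.syzygy j q hj hjq hq hXn
  -- Lifting q through b' and restricting to kernels yields the map v : ΩX → ΩY along which the row
  -- is a pushout.
  obtain ⟨l, hl⟩ := Module.projective_lifting_property b' q hb'
  obtain ⟨v, hv⟩ := exists_lift_of_exact ha' hab' (l ∘ₗ j) (by
    rw [← LinearMap.comp_assoc, hl, hjq.linearMap_comp_eq_zero])
  have hL : stableProp (generatedIn P (r + 2)) L := by
    refine ⟨hLCM, .of ⟨_, _, stHom (M := ⟨A, hA.1⟩) (N := ⟨L, hLCM⟩) v,
      stHom (M := ⟨L, hLCM⟩) (N := ⟨_, hKm.1⟩) a', hA.2, hKm.2,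
      cmComplex (A := ⟨A, hA.1⟩) (B := ⟨_, isCM_free k⟩) (C := ⟨_, hXn.1⟩) j q hjq,
      cmComplex (A := ⟨L, hLCM⟩) (B := ⟨_, hKm.1⟩) (C := ⟨_, hXn.1⟩) a' b' hab',
      { τ₁ := ObjectProperty.homMk (ModuleCat.ofHom v)
        τ₂ := ObjectProperty.homMk (ModuleCat.ofHom l)
        τ₃ := 𝟙 _
        comm₁₂ := ?_
        comm₂₃ := ?_ }, isConflation_cmComplex hj hjq hq, ?_, isConflation_cmComplex ha' hab' hb',
      ?_, Iso.refl _, Iso.refl _, Iso.refl _, ?_, ?_⟩⟩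
    · ext x
      exact LinearMap.congr_fun hv x
    · ext x
      exact LinearMap.congr_fun hl x
    · exact inferInstanceAs (Module.Projective R (Fin k → R))
    · exact IsIso.id (C := CMCat R) _
    · exact (Category.comp_id _).trans (Category.id_comp _).symm
    · exact (Category.comp_id _).trans (Category.id_comp _).symm
  exact stableProp_of_cosyz hYCM ⟨m, L, i', p', hi', hip', hp', hL⟩

lemma iterate_cosyz_isGood {Q : ObjectProperty (ModuleCat.{u} R)} (hQ : IsGood Q) (n : ℕ) :
    IsGood (cosyz^[n] Q) := by
  induction n with
  | zero => exact hQ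
  | succ n ih =>
    rw [Function.iterate_succ', Function.comp_apply]
    exact isGood_cosyz ih

lemma extClosed_iterate_cosyz {Q₁ Q₂ Q₃ : ObjectProperty (ModuleCat.{u} R)} (hQ₃ : IsGood Q₃)
    (H : ExtClosed Q₁ Q₂ Q₃) (n : ℕ) :
    ExtClosed (cosyz^[n] Q₁) (cosyz^[n] Q₂) (cosyz^[n] Q₃) := by
  induction n with
  | zero => exact H
  | succ n ih =>
    simp only [Function.iterate_succ', Function.comp_apply]
    exact extClosed_cosyz (iterate_cosyz_isGood hQ₃ n) ih

lemma ball_le_iterate_cosyz (P : ObjectProperty (StableCM R)) (C : ModuleCat.{u} R) (n : ℕ)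
    (hC : cosyz^[n] (stableProp (generatedIn P 1)) C) (r : ℕ) :
    ball (single C) (r + 1) ≤ cosyz^[n] (stableProp (generatedIn P (r + 1))) := by
  have hgood := fun r => iterate_cosyz_isGood (isGood_stableProp P r) n
  have h1 : bracket (single C) ≤ cosyz^[n] (stableProp (generatedIn P 1)) :=
    (hgood 0).bracket_le fun M hM => (hgood 0).of_equiv hM.some hC
  induction r with
  | zero => exact h1
  | succ r ih =>
    refine (hgood (r + 1)).bracket_le ?_
    rintro M ⟨X, Y, f, g, hX, hY, hf, h, hg⟩
    exact extClosed_iterate_cosyz (isGood_stableProp P (r + 1)) (extClosed_stableProp P r) n _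
      ⟨X, Y, f, g, (hgood r).bracket_le ih _ hX, h1 _ hY, hf, h, hg⟩

variable (R) in
theorem stableDim_le_radius : stableDim R ≤ radius (isCM R) := by
  refine le_iInf₂ fun n ⟨C, hC, hle⟩ => iInf₂_le n ?_
  obtain ⟨G, hG, hG', hGC⟩ := exists_iterate_cosyz (dimNat R) 0 C
    (fun i hi => absurd hi (by omega)) (by omega)
  have hGCM : isCM R G := (isCM_iff G).2 ⟨hG, hG'.mono (by omega)⟩
  let G' : StableCM R := (toStable R).obj ⟨G, hGCM⟩
  refine ⟨G', top_le_iff.1 fun X _ => ?_⟩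
  have h₁ := hle _ X.as.property
  have h₂ := ball_le_iterate_cosyz (stableSingle G') C (dimNat R)
    (hGC _ ⟨hGCM, .of ⟨Iso.refl _⟩⟩) n _ h₁
  obtain ⟨P', hP'⟩ := generatedIn_succ (stableSingle G') n
  rw [hP'] at h₂ ⊢
  exact (stableProp_of_iterate_cosyz _ X.as.property h₂).2

end Radius

end CMRadius
namespace CMRadius

open IsLocalRing

/-! ### From triangles back to module extensions -/

section Dimension

variable {R : Type u} [CommRing R] [IsLocalRing R]

/-- The difference g ∘ f − 1 factors as b ∘ a through a projective P, so (f, a) and (g, −b) make X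
an honest retract of Y ⊕ P. -/
lemma IsGood.of_stable_retract {B : ObjectProperty (ModuleCat.{u} R)} (hB : IsGood B)
    {X Y : StableCM R} (r : Retract X Y) (hY : B Y.as.obj) : B X.as.obj := by
  obtain ⟨f, hf⟩ := stHom_surjective (M := X.as) (N := Y.as) r.i
  obtain ⟨g, hg⟩ := stHom_surjective (M := Y.as) (N := X.as) r.r
  have h : stHom (M := X.as) (N := X.as) (g ∘ₗ f) = stHom LinearMap.id := by
    rw [stHom_id, ← stHom_comp, hf, hg]
    exact r.retract
  obtain ⟨P, _, _, a, b, hab⟩ := (stHom_eq_iff (M := X.as) (N := X.as) _ _).1 h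
  have hab' : ∀ x, b.hom (a.hom x) = g (f x) - x := fun x =>
    congrArg (fun φ : X.as.obj ⟶ X.as.obj => φ.hom x) hab
  refine hB.retract (Y := ModuleCat.of R (Y.as.obj × P)) (f.prod a.hom) (g.coprod (-b.hom)) ?_
    (hB.prod hY (hB.projective P))
  ext x
  simp [hab']

lemma IsConflation.exact {S : ShortComplex (CMCat R)} (hS : IsConflation S) :
    Function.Injective S.f.hom.hom ∧ Function.Exact S.f.hom.hom S.g.hom.hom ∧
      Function.Surjective S.g.hom.hom :=
  have h : (S.map (isCM R).ι).ShortExact := hS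
  ⟨h.moduleCat_injective_f, (ShortComplex.ShortExact.moduleCat_exact_iff_function_exact _).1
    h.exact, h.moduleCat_surjective_g⟩

variable [IsNoetherianRing R]

lemma IsGood.of_generated {B : ObjectProperty (ModuleCat.{u} R)} (hB : IsGood B)
    (hsusp : ∀ T, isCM R T → cosyz B T → B T) {P : ObjectProperty (StableCM R)}
    (hP : ∀ X, P X → B X.as.obj) {X : StableCM R} (hX : generated P X) : B X.as.obj := by
  induction hX with
  | of h => exact hP _ h
  | @zero X h =>
    let Z : CMCat R := ⟨ModuleCat.of R PUnit.{u + 1},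
      inferInstanceAs (Module.Finite R PUnit.{u + 1}),
      .inl (inferInstanceAs (Subsingleton PUnit.{u + 1}))⟩
    exact hB.of_stable_retract (Y := (toStable R).obj Z) ⟨0, 0, h.eq_of_src _ _⟩
      (hB.of_subsingleton (inferInstanceAs (Subsingleton PUnit.{u + 1})))
  | @sum X Y hX hY b hb ihX ihY =>
    let W : CMCat R := ⟨_, isCM_prod X.as.property Y.as.property⟩
    obtain ⟨f, hf⟩ := stHom_surjective (M := b.pt.as) (N := X.as) b.fst
    obtain ⟨s, hs⟩ := stHom_surjective (M := b.pt.as) (N := Y.as) b.snd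
    obtain ⟨i, hi⟩ := stHom_surjective (M := X.as) (N := b.pt.as) b.inl
    obtain ⟨j, hj⟩ := stHom_surjective (M := Y.as) (N := b.pt.as) b.inr
    -- The abstract biproduct is compared with the module X × Y: the identity `fst ≫ inl + snd ≫ inr
    -- = 𝟙` makes it a stable retract.
    refine hB.of_stable_retract (Y := (toStable R).obj W)
      ⟨stHom (M := b.pt.as) (N := W) (f.prod s), stHom (M := W) (N := b.pt.as) (i.coprod j), ?_⟩
      (hB.prod ihX ihY)
    have htot := IsBilimit.binary_total hb
    rw [← hf, ← hs, ← hi, ← hj] at htot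
    have h₁ := stHom_comp (M := b.pt.as) (N := X.as) (L := b.pt.as) f i
    have h₂ := stHom_comp (M := b.pt.as) (N := Y.as) (L := b.pt.as) s j
    refine (stHom_comp (M := b.pt.as) (N := W) (L := b.pt.as) (f.prod s) (i.coprod j)).trans
      (Eq.trans ?_ htot)
    refine Eq.trans ?_ (congrArg₂ (· + ·) h₁.symm h₂.symm)
    rw [← stHom_add]
    congr 1
  | summand _ r ih => exact hB.of_stable_retract r ih
  | suspension hX h ih =>
    obtain ⟨S, hS, hS₂, ⟨a⟩, ⟨c⟩⟩ := h
    obtain ⟨h₁, h₂, h₃⟩ := hS.exact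
    have := S.X₂.property.1
    have hA : B S.X₁.obj := hB.of_stable_retract (X := (toStable R).obj S.X₁)
      ⟨a.inv, a.hom, a.inv_hom_id⟩ ih
    exact hB.of_stable_retract (Y := (toStable R).obj S.X₃) ⟨c.hom, c.inv, c.hom_inv_id⟩
      (hsusp _ S.X₃.property ((hB.cosyz_iff h₁ h₂ h₃).2 hA))
  | desuspension hT h ih =>
    obtain ⟨S, hS, hS₂, ⟨a⟩, ⟨c⟩⟩ := h
    obtain ⟨h₁, h₂, h₃⟩ := hS.exact
    have := S.X₂.property.1
    have hC : B S.X₃.obj := hB.of_stable_retract (X := (toStable R).obj S.X₃)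
      ⟨c.inv, c.hom, c.inv_hom_id⟩ ih
    exact hB.of_stable_retract (Y := (toStable R).obj S.X₁) ⟨a.hom, a.inv, a.hom_inv_id⟩
      (hB.syzygy_of_projective h₁ h₂ h₃ hC)

omit [IsNoetherianRing R] in
-- With τ₃ invertible, the left square of the pushout diagram unrolls to 0 → A → B ⊕ I → C → 0. Thus
-- B ⊕ I, and with it the summand B, lies in the third class.
lemma IsGood.of_star {B₁ B₂ B₃ : ObjectProperty (ModuleCat.{u} R)} (hB₁ : IsGood B₁)
    (hB₂ : IsGood B₂) (hB₃ : IsGood B₃) (H : ExtClosed B₁ B₂ B₃) {P Q : ObjectProperty (StableCM R)}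
    (hP : ∀ X, P X → B₁ X.as.obj) (hQ : ∀ X, Q X → B₂ X.as.obj) (X : StableCM R)
    (hX : star P Q X) : B₃ X.as.obj := by
  obtain ⟨Y, Z, -, -, hY, hZ, S, S', φ, hS, hS₂, hS', hφ, a, b, c, -, -⟩ := hX
  obtain ⟨h₁, h₂, h₃⟩ := hS.exact
  obtain ⟨h₁', h₂', h₃'⟩ := hS'.exact
  have hA : B₁ S.X₁.obj := hB₁.of_stable_retract (X := (toStable R).obj S.X₁)
    ⟨a.inv, a.hom, a.inv_hom_id⟩ (hP _ hY)
  have hC : B₂ S'.X₂.obj := hB₂.of_stable_retract (X := (toStable R).obj S'.X₂)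
    ⟨c.inv, c.hom, c.inv_hom_id⟩ (hQ _ hZ)
  have e₁ : ∀ x, φ.τ₂.hom.hom (S.f.hom.hom x) = S'.f.hom.hom (φ.τ₁.hom.hom x) := fun x =>
    (congrArg (fun ψ : S.X₁ ⟶ S'.X₂ => ψ.hom.hom x) φ.comm₁₂).symm
  have e₂ : ∀ x, φ.τ₃.hom.hom (S.g.hom.hom x) = S'.g.hom.hom (φ.τ₂.hom.hom x) := fun x =>
    (congrArg (fun ψ : S.X₂ ⟶ S'.X₃ => ψ.hom.hom x) φ.comm₂₃).symm
  have hbij : Function.Bijective φ.τ₃.hom.hom :=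
    ConcreteCategory.bijective_of_isIso (C := ModuleCat.{u} R) φ.τ₃.hom
  have hB : B₃ (ModuleCat.of R (S'.X₁.obj × S.X₂.obj)) := by
    refine H _ ⟨S.X₁.obj, S'.X₂.obj, φ.τ₁.hom.hom.prod (-S.f.hom.hom),
      S'.f.hom.hom.coprod φ.τ₂.hom.hom, hA, hC, ?_, ?_, ?_⟩
    · intro x y hxy
      exact h₁ (neg_injective (congrArg Prod.snd hxy))
    · rintro ⟨y, x⟩
      constructor
      · intro h
        have h : S'.f.hom.hom y + φ.τ₂.hom.hom x = 0 := h
        obtain ⟨z, rfl⟩ := (h₂ x).1 (hbij.1 (by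
          rw [e₂, map_zero, ← map_zero S'.g.hom.hom, ← h, map_add,
            h₂'.apply_apply_eq_zero, zero_add]))
        refine ⟨-z, Prod.ext (h₁' ?_) ?_⟩
        · rw [e₁] at h
          change S'.f.hom.hom (φ.τ₁.hom.hom (-z)) = _
          rw [map_neg, map_neg]
          exact (eq_neg_of_add_eq_zero_left h).symm
        · change -S.f.hom.hom (-z) = _
          rw [map_neg, neg_neg]
      · rintro ⟨z, hz⟩
        rw [← hz]
        change S'.f.hom.hom (φ.τ₁.hom.hom z) + φ.τ₂.hom.hom (-S.f.hom.hom z) = 0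
        rw [map_neg, e₁, add_neg_cancel]
    · intro z
      obtain ⟨w, hw⟩ := hbij.2 (S'.g.hom.hom z)
      obtain ⟨x, rfl⟩ := h₃ w
      obtain ⟨y, hy⟩ := (h₂' (z - φ.τ₂.hom.hom x)).1 (by rw [map_sub, ← e₂, hw, sub_self])
      exact ⟨(y, x), (congrArg (· + φ.τ₂.hom.hom x) hy).trans (sub_add_cancel _ _)⟩
  refine hB₃.of_stable_retract (Y := (toStable R).obj S'.X₁) ⟨b.hom, b.inv, b.hom_inv_id⟩ ?_
  exact hB₃.retract (Y := ModuleCat.of R (S'.X₁.obj × S.X₂.obj)) (LinearMap.inl R _ _)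
    (LinearMap.fst R _ _) (by ext; simp) hB

lemma ball_of_generatedIn (G : StableCM R)
    (hsusp : ∀ B : ObjectProperty (ModuleCat.{u} R), IsGood B → ∀ T, isCM R T → cosyz B T → B T)
    (r : ℕ) {X : StableCM R} (hX : generatedIn (stableSingle G) (r + 1) X) :
    ball (single G.as.obj) (r + 1) X.as.obj := by
  have hfin : ∀ M, single G.as.obj M → Module.Finite R M := fun M ⟨e⟩ =>
    have := G.as.property.1
    Module.Finite.equiv e.symm
  have hgood := ball_isGood hfin
  have h1 : ∀ X, generated (stableSingle G) X → ball (single G.as.obj) 1 X.as.obj := by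
    intro X hX
    refine (hgood 0).of_generated (hsusp _ (hgood 0)) ?_ hX
    rintro X ⟨e⟩
    exact (hgood 0).of_stable_retract ⟨e.hom, e.inv, e.hom_inv_id⟩
      (le_bracket _ _ ⟨LinearEquiv.refl R _⟩)
  induction r generalizing X with
  | zero => exact h1 X hX
  | succ r ih =>
    refine (hgood (r + 1)).of_generated (hsusp _ (hgood (r + 1))) ?_ hX
    refine (hgood r).of_star (hgood 0) (hgood (r + 1)) ?_ (fun X hX => ih hX) h1
    rintro M ⟨X, Y, f, g, hX, hY, h⟩
    exact le_bracket _ _ ⟨X, Y, f, g, le_bracket _ _ hX, hY, h⟩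

/-- The hypothesis supplies the one closure property that `generated` has and balls may lack,
suspension. -/
theorem radius_le_stableDim
    (hsusp : ∀ B : ObjectProperty (ModuleCat.{u} R), IsGood B → ∀ T, isCM R T → cosyz B T → B T) :
    radius (isCM R) ≤ stableDim R := by
  refine le_iInf₂ fun n ⟨G, hG⟩ => iInf₂_le n ⟨G.as.obj, G.as.property.1, fun M hM => ?_⟩
  have h : generatedIn (stableSingle G) (n + 1) ((toStable R).obj ⟨M, hM⟩) := by
    rw [hG]
    trivial
  exact ball_of_generatedIn G hsusp n h

end Dimension

end CMRadius
namespace CMRadius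

/-! ### Regular local rings and their maximal Cohen–Macaulay modules -/

section Regular

open IsLocalRing RingTheory.Sequence Pointwise

section

variable {S : Type u} [CommRing S]

lemma isLocalRing_quotient_span [IsLocalRing S] {x : S} (hx : x ∈ maximalIdeal S) :
    IsLocalRing (S ⧸ Ideal.span {x}) := by
  have : Nontrivial (S ⧸ Ideal.span {x}) := Ideal.Quotient.nontrivial_iff.2 fun h =>
    (maximalIdeal.isMaximal S).ne_top (top_le_iff.1 (h ▸ (Ideal.span_singleton_le_iff_mem _).2 hx))
  exact .of_surjective' _ Ideal.Quotient.mk_surjective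

lemma map_mk_maximalIdeal [IsLocalRing S] {x : S} [IsLocalRing (S ⧸ Ideal.span {x})] :
    (maximalIdeal S).map (Ideal.Quotient.mk (Ideal.span {x})) =
      maximalIdeal (S ⧸ Ideal.span {x}) := by
  have : IsLocalHom (Ideal.Quotient.mk (Ideal.span {x})) :=
    .of_surjective _ Ideal.Quotient.mk_surjective
  rw [← maximalIdeal_comap (Ideal.Quotient.mk (Ideal.span {x})),
    Ideal.map_comap_of_surjective _ Ideal.Quotient.mk_surjective]

/-- An element outside 𝔪² is nonzero in the cotangent space, so it extends to a basis there;
Nakayama lifts the basis to generators. -/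
lemma exists_generators_maximalIdeal [IsLocalRing S] [IsNoetherianRing S] {x : S}
    (hx : x ∈ maximalIdeal S) (hx' : x ∉ maximalIdeal S ^ 2) :
    ∃ t : Set S, t.Finite ∧ t.ncard + 1 ≤ (maximalIdeal S).spanFinrank ∧
      Ideal.span (insert x t) = maximalIdeal S := by
  classical
  let q := (maximalIdeal S).toCotangent
  have hv : q ⟨x, hx⟩ ≠ 0 := fun h => hx' (((maximalIdeal S).toCotangent_eq_zero _).1 h)
  have hli : LinearIndepOn (ResidueField S) id ({q ⟨x, hx⟩} : Set (CotangentSpace S)) :=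
    .singleton hv
  let b := hli.extend (Set.subset_univ _)
  let B := Module.Basis.extend hli
  have hvb : q ⟨x, hx⟩ ∈ b := hli.subset_extend _ rfl
  have hfin : b.Finite := Set.finite_coe_iff.1 (Module.Finite.finite_basis B)
  have hcard : b.ncard = (maximalIdeal S).spanFinrank := by
    rw [spanFinrank_maximalIdeal_eq_finrank_cotangentSpace, ← Nat.card_coe_set_eq,
      Module.finrank_eq_nat_card_basis B]
  obtain ⟨g, hg⟩ := (maximalIdeal S).toCotangent_surjective.hasRightInverse
  have hspan : Submodule.span S (insert ⟨x, hx⟩ (g '' (b \ {q ⟨x, hx⟩}))) =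
      (⊤ : Submodule S (maximalIdeal S)) := by
    rw [← CotangentSpace.span_image_eq_top_iff, Set.image_insert_eq, Set.image_image]
    simp only [hg _, Set.image_id']
    rw [Set.insert_sdiff_singleton, Set.insert_eq_of_mem hvb, ← B.span_eq]
    congr 1
    exact (Module.Basis.range_extend hli).symm
  refine ⟨(fun y : maximalIdeal S => (y : S)) '' ((g '' (b \ {q ⟨x, hx⟩}) :)), ((hfin.sdiff).image _).image _, ?_, ?_⟩
  · rw [← hcard, ← Set.ncard_sdiff_singleton_add_one hvb hfin]
    gcongr
    exact (Set.ncard_image_le (hfin.sdiff.image _)).trans (Set.ncard_image_le hfin.sdiff)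
  · have := congrArg (Submodule.map (maximalIdeal S).subtype) hspan
    rw [Submodule.map_span, Submodule.map_top, Submodule.range_subtype, Set.image_insert_eq] at this
    exact this

/-- The embedding dimension drops by at least one and the Krull dimension by at most one; as they
agree on S, both drop by exactly one. -/
lemma isRegularLocalRing_quotient_span [IsRegularLocalRing S] {x : S}
    (hx : x ∈ maximalIdeal S) (hx' : x ∉ maximalIdeal S ^ 2) :
    IsRegularLocalRing (S ⧸ Ideal.span {x}) ∧
      dimNat (S ⧸ Ideal.span {x}) + 1 = dimNat S := by
  have := isLocalRing_quotient_span hx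
  obtain ⟨t, ht, hcard, hspan⟩ := exists_generators_maximalIdeal hx hx'
  have hmap : maximalIdeal (S ⧸ Ideal.span {x}) =
      Ideal.span (Ideal.Quotient.mk (Ideal.span {x}) '' t) := by
    rw [← Ideal.map_span, ← map_mk_maximalIdeal, ← hspan, Ideal.map_span, Ideal.map_span, Set.image_insert_eq,
      Ideal.Quotient.eq_zero_iff_mem.2 (Ideal.mem_span_singleton_self x), Ideal.span_insert_zero]
  have h₁ : (maximalIdeal (S ⧸ Ideal.span {x})).spanFinrank + 1 ≤ (maximalIdeal S).spanFinrank := by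
    rw [hmap]
    exact (Nat.add_le_add_right ((Submodule.spanFinrank_span_le_ncard_of_finite (ht.image _)).trans
      (Set.ncard_image_le ht)) 1).trans hcard
  have h₂ := ringKrullDim_le_spanFinrank_maximalIdeal (S ⧸ Ideal.span {x})
  have h₃ : ringKrullDim S ≤ ringKrullDim (S ⧸ Ideal.span {x}) + 1 := by
    have h := ringKrullDim_le_ringKrullDim_quotSMulTop_succ hx
    rwa [← Submodule.ideal_span_singleton_smul, smul_eq_mul, Ideal.mul_top] at h
  have h₄ := IsRegularLocalRing.spanFinrank_maximalIdeal (R := S)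
  rw [← coe_dimNat] at h₂
  rw [← coe_dimNat, ← coe_dimNat (S ⧸ Ideal.span {x})] at h₃
  rw [← coe_dimNat] at h₄
  have h₂' : dimNat (S ⧸ Ideal.span {x}) ≤ (maximalIdeal (S ⧸ Ideal.span {x})).spanFinrank := by
    exact_mod_cast h₂
  have h₃' : dimNat S ≤ dimNat (S ⧸ Ideal.span {x}) + 1 := by exact_mod_cast h₃
  have h₄' : (maximalIdeal S).spanFinrank = dimNat S := by exact_mod_cast h₄
  refine ⟨.of_spanFinrank_maximalIdeal_le _ ?_, by omega⟩
  rw [← coe_dimNat]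
  exact_mod_cast (by omega : (maximalIdeal (S ⧸ Ideal.span {x})).spanFinrank ≤ _)

/-- Prime avoidance tolerates the non-prime 𝔪² as one member of the union, and 𝔪 ⊆ 𝔪² is excluded by
Nakayama. -/
lemma exists_mem_maximalIdeal_notMem [IsLocalRing S] [IsNoetherianRing S]
    (hS : maximalIdeal S ≠ ⊥) {T : Set (Ideal S)} (hT : T.Finite)
    (hp : ∀ p ∈ T, p.IsPrime ∧ p ≠ maximalIdeal S) :
    ∃ x ∈ maximalIdeal S, x ∉ maximalIdeal S ^ 2 ∧ ∀ p ∈ T, x ∉ p := by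
  by_contra! hcon
  have hsub : (maximalIdeal S : Set S) ⊆ ⋃ p ∈ insert (maximalIdeal S ^ 2) T, (id p : Ideal S) := by
    intro x hx
    simp only [Set.mem_iUnion]
    by_cases hx' : x ∈ maximalIdeal S ^ 2
    · exact ⟨_, Set.mem_insert _ _, hx'⟩
    · obtain ⟨p, hp, hxp⟩ := hcon x hx hx'
      exact ⟨p, Set.mem_insert_of_mem _ hp, hxp⟩
  rw [Ideal.subset_union_prime_finite (hT.insert _) (maximalIdeal S ^ 2) (maximalIdeal S ^ 2)] at hsub
  · obtain ⟨p, hpT, hle⟩ := hsub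
    rcases Set.mem_insert_iff.1 hpT with rfl | hpT
    · refine hS (Submodule.eq_bot_of_le_smul_of_le_jacobson_bot (maximalIdeal S) _
        (maximalIdeal S).fg_of_isNoetherianRing ?_ (maximalIdeal_le_jacobson _))
      simpa [sq] using hle
    · exact (hp p hpT).2 ((maximalIdeal.isMaximal S).eq_of_le (hp p hpT).1.ne_top hle).symm
  · intro p hpT h _
    exact (hp p ((Set.mem_insert_iff.1 hpT).resolve_left h)).1

lemma maximalIdeal_ne_bot_of_dimNat_eq_succ [IsLocalRing S] [IsNoetherianRing S] {e : ℕ}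
    (h : dimNat S = e + 1) : maximalIdeal S ≠ ⊥ := by
  intro hbot
  have : IsField S := isField_iff_maximalIdeal_eq.2 hbot
  have := coe_dimNat S
  rw [ringKrullDim_eq_zero_of_isField ‹_›, h] at this
  exact absurd (by exact_mod_cast this : e + 1 = 0) (by omega)

lemma isField_of_dimNat_eq_zero [IsRegularLocalRing S] (h : dimNat S = 0) : IsField S := by
  rw [isField_iff_maximalIdeal_eq,
    ← Submodule.spanFinrank_eq_zero_iff_eq_bot (maximalIdeal S).fg_of_isNoetherianRing]
  have := IsRegularLocalRing.spanFinrank_maximalIdeal (R := S)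
  rw [← coe_dimNat, h] at this
  exact_mod_cast this

lemma notMem_minimalPrimes_maximalIdeal [IsLocalRing S] [IsNoetherianRing S] {e : ℕ}
    (h : dimNat S = e + 1) : maximalIdeal S ∉ minimalPrimes S := by
  intro hmem
  have h₀ : (maximalIdeal S).height = 0 := (Ideal.height_eq_zero_iff).2 hmem
  have h₁ := maximalIdeal_height_eq_ringKrullDim (R := S)
  rw [h₀, ← coe_dimNat, h] at h₁
  exact absurd (by exact_mod_cast h₁ : 0 = e + 1) (by omega)

/-- Choose x outside 𝔪² and outside every minimal prime. By induction (x) is prime, hence contains a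
minimal prime q; as x ∉ q, every element of q is x times an element of q, and Nakayama gives q = 0.
-/
lemma isDomain_of_isRegularLocalRing (S : Type u) [CommRing S] [IsRegularLocalRing S] :
    IsDomain S := by
  obtain ⟨e, he⟩ : ∃ e, dimNat S = e := ⟨_, rfl⟩
  induction e generalizing S with
  | zero => exact (isField_of_dimNat_eq_zero he).isDomain
  | succ e ih =>
    obtain ⟨x, hx, hx', hxT⟩ := exists_mem_maximalIdeal_notMem
      (maximalIdeal_ne_bot_of_dimNat_eq_succ he) (minimalPrimes.finite_of_isNoetherianRing S)
      (fun p hp => ⟨hp.1.1, fun h => notMem_minimalPrimes_maximalIdeal he (h ▸ hp)⟩)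
    obtain ⟨hreg, hdim⟩ := isRegularLocalRing_quotient_span hx hx'
    have := ih (S ⧸ Ideal.span {x}) (by omega)
    have hprime : (Ideal.span {x}).IsPrime := (Ideal.Quotient.isDomain_iff_prime _).1 this
    obtain ⟨q, hq, hle⟩ := Ideal.exists_minimalPrimes_le (bot_le : ⊥ ≤ Ideal.span {x})
    have hqp : q.IsPrime := hq.1.1
    have hbot : q = ⊥ := by
      refine Submodule.eq_bot_of_le_smul_of_le_jacobson_bot (maximalIdeal S) _
        q.fg_of_isNoetherianRing ?_ (maximalIdeal_le_jacobson _)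
      intro y hy
      obtain ⟨z, rfl⟩ := Ideal.mem_span_singleton'.1 (hle hy)
      rw [mul_comm]
      exact Ideal.mul_mem_mul hx ((hqp.mem_or_mem hy).resolve_right (hxT q hq))
    have : (⊥ : Ideal S).IsPrime := hbot ▸ hqp
    exact IsDomain.of_bot_isPrime S

lemma DepthGE.of_exact_right {n : ℕ} [IsLocalRing S] {X Y Z : ModuleCat.{u} S} {f : X →ₗ[S] Y}
    {g : Y →ₗ[S] Z} (hf : Function.Injective f) (h : Function.Exact f g)
    (hg : Function.Surjective g) (hX : DepthGE (n + 1) X) (hY : DepthGE n Y) : DepthGE n Z := by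
  intro i hi
  have h₁ := hX (i + 1) (by omega)
  have h₂ := hY i hi
  refine subsingleton_of_forall_eq 0 fun y => ?_
  obtain ⟨x, rfl⟩ := Abelian.Ext.covariant_sequence_exact₃ _ (sesComplex_shortExact hf h hg) y rfl
    (h₁.elim _ _)
  rw [h₂.elim x 0, Abelian.Ext.zero_comp]

lemma DepthGE.quotSMulTop {n : ℕ} [IsLocalRing S] {N : ModuleCat.{u} S} {x : S}
    (hx : IsSMulRegular N x) (hN : DepthGE (n + 1) N) :
    DepthGE n (ModuleCat.of S (QuotSMulTop x N)) := by
  refine .of_exact_right (X := N) (Y := N) (f := LinearMap.lsmul S N x)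
    (g := (x • (⊤ : Submodule S N)).mkQ) hx ?_ (Submodule.mkQ_surjective _) hN (hN.mono (by omega))
  rw [LinearMap.exact_iff, Submodule.ker_mkQ]
  ext y
  simp [Submodule.mem_smul_pointwise_iff_exists]

lemma DepthGE.quotient_span {n : ℕ} [IsLocalRing S] [IsNoetherianRing S] {x : S}
    [IsLocalRing (S ⧸ Ideal.span {x})] {N : Type u} [AddCommGroup N] [Module S N]
    [Module (S ⧸ Ideal.span {x}) N] [IsScalarTower S (S ⧸ Ideal.span {x}) N] [Module.Finite S N]
    (hN : DepthGE n (ModuleCat.of S N)) : DepthGE n (ModuleCat.of (S ⧸ Ideal.span {x}) N) := by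
  have := Module.Finite.of_restrictScalars_finite S (S ⧸ Ideal.span {x}) N
  obtain ⟨rs, h₁, h₂, h₃⟩ := (depthGE_iff n (ModuleCat.of S N)).1 hN
  refine (depthGE_iff n _).2 ⟨rs.map (algebraMap S (S ⧸ Ideal.span {x})), by simpa, ?_,
    (isWeaklyRegular_map_algebraMap_iff _ _ _).2 h₃⟩
  intro r hr
  obtain ⟨s, hs, rfl⟩ := List.mem_map.1 hr
  rw [← map_mk_maximalIdeal]
  exact Ideal.mem_map_of_mem _ (h₂ s hs)

lemma depthGE_self_of_isRegularLocalRing (S : Type u) [CommRing S] [IsRegularLocalRing S] :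
    DepthGE (dimNat S) (ModuleCat.of S S) := by
  obtain ⟨e, he⟩ : ∃ e, dimNat S = e := ⟨_, rfl⟩
  rw [he]
  induction e generalizing S with
  | zero => exact fun i hi => absurd hi (Nat.not_lt_zero i)
  | succ e ih =>
    have := isDomain_of_isRegularLocalRing S
    obtain ⟨x, hx, hx', -⟩ := exists_mem_maximalIdeal_notMem
      (maximalIdeal_ne_bot_of_dimNat_eq_succ he) Set.finite_empty (by simp)
    obtain ⟨hreg, hdim⟩ := isRegularLocalRing_quotient_span hx hx'
    obtain ⟨rs, h₁, h₂, h₃⟩ := (depthGE_iff _ _).1 (ih (S ⧸ Ideal.span {x}) (by omega))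
    have : IsLocalHom (Ideal.Quotient.mk (Ideal.span {x})) :=
      .of_surjective _ Ideal.Quotient.mk_surjective
    obtain ⟨ts, rfl⟩ := List.map_surjective_iff.2 (Ideal.Quotient.mk_surjective (I := Ideal.span {x}))
      rs
    have hx₀ : x ≠ 0 := fun h => hx' (h ▸ zero_mem _)
    refine (depthGE_iff _ _).2 ⟨x :: ts, by simpa using h₁, ?_,
      .cons' (IsSMulRegular.of_ne_zero hx₀) ?_⟩
    · intro r hr
      rcases List.mem_cons.1 hr with rfl | hr
      · exact hx
      · rw [← maximalIdeal_comap (Ideal.Quotient.mk (Ideal.span {x}))]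
        exact h₂ _ (List.mem_map_of_mem hr)
    · have heq : x • (⊤ : Submodule S S) = Ideal.span {x} := by
        rw [← Submodule.ideal_span_singleton_smul, smul_eq_mul, Ideal.mul_top]
      exact (((Submodule.quotEquivOfEq _ _ heq).extendScalarsOfSurjective
        (Ideal.Quotient.mk_surjective (I := Ideal.span {x}))).isWeaklyRegular_congr _).2 h₃

/-- The case of Auslander–Buchsbaum that is needed. Choose x outside 𝔪² and outside the associated
primes of N: then N/xN has full depth over the regular ring S/(x), is free by induction, and
freeness lifts along the N-regular element x. -/
lemma free_of_depthGE (S : Type u) [CommRing S] [IsRegularLocalRing S] (N : Type u)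
    [AddCommGroup N] [Module S N] [Module.Finite S N]
    (hN : DepthGE (dimNat S) (ModuleCat.of S N)) : Module.Free S N := by
  obtain ⟨e, he⟩ : ∃ e, dimNat S = e := ⟨_, rfl⟩
  rw [he] at hN
  induction e generalizing S N with
  | zero =>
    let _ := (isField_of_dimNat_eq_zero he).toField
    exact Module.Free.of_divisionRing S N
  | succ e ih =>
    rcases subsingleton_or_nontrivial N with h | h
    · infer_instance
    obtain ⟨y, hy, hyN⟩ : ∃ y ∈ maximalIdeal S, IsSMulRegular N y := by
      obtain ⟨rs, h₁, h₂, h₃⟩ := (depthGE_iff _ _).1 hN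
      match rs, h₁ with
      | y :: rs, _ => exact ⟨y, h₂ y (by simp), ((isWeaklyRegular_cons_iff _ _ _).1 h₃).1⟩
    have hreg : ∀ z, IsSMulRegular N z ↔ ∀ p ∈ associatedPrimes S N, z ∉ p := by
      intro z
      have := Set.ext_iff.1 (biUnion_associatedPrimes_eq_compl_regular S N) z
      simp only [Set.mem_iUnion, SetLike.mem_coe, Set.mem_compl_iff, Set.mem_ofPred_eq] at this
      rw [← not_iff_not, ← this]
      push Not
      simp
    obtain ⟨x, hx, hx', hxT⟩ := exists_mem_maximalIdeal_notMem
      (maximalIdeal_ne_bot_of_dimNat_eq_succ he) (associatedPrimes.finite S N)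
      (fun p hp => ⟨hp.isPrime, fun h => (hreg y).1 hyN p hp (h ▸ hy)⟩)
    have hxN := (hreg x).2 hxT
    obtain ⟨_, hdim⟩ := isRegularLocalRing_quotient_span hx hx'
    have := Module.Finite.of_restrictScalars_finite S (S ⧸ Ideal.span {x}) (QuotSMulTop x N)
    have := ih (S ⧸ Ideal.span {x}) (QuotSMulTop x N)
      (DepthGE.quotient_span (hN.quotSMulTop (N := ModuleCat.of S N) hxN)) (by omega)
    have hfp := Module.finitePresentation_of_finite S N
    exact (Module.free_quotSMulTop_iff_free S N (maximalIdeal_le_jacobson _ hx) hxN).1 this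

end
end Regular
end CMRadius
namespace CMRadius

/-! ### Two-periodic resolutions over S/(f) -/

section Periodicity

open IsLocalRing RingTheory.Sequence Pointwise

/-- A module which is a second syzygy of itself up to projectives is a retract of any second
syzygy of itself up to projectives. -/
lemma exists_retract_of_periodic {A : Type*} [Ring A] {M K L F₁ F₀ F₁' F₀' : Type*}
    [AddCommGroup M] [Module A M] [AddCommGroup K] [Module A K] [AddCommGroup L] [Module A L]
    [AddCommGroup F₁] [Module A F₁] [AddCommGroup F₀] [Module A F₀]
    [AddCommGroup F₁'] [Module A F₁'] [AddCommGroup F₀'] [Module A F₀']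
    [Module.Projective A F₁] [Module.Projective A F₀] [Module.Projective A F₁']
    [Module.Projective A F₀']
    {i₁ : K →ₗ[A] F₁} {p₁ : F₁ →ₗ[A] L} {i₀ : L →ₗ[A] F₀} {p₀ : F₀ →ₗ[A] M}
    (hi₁ : Function.Injective i₁) (h₁ : Function.Exact i₁ p₁) (hp₁ : Function.Surjective p₁)
    (hi₀ : Function.Injective i₀) (h₀ : Function.Exact i₀ p₀) (hp₀ : Function.Surjective p₀)
    {κ : M →ₗ[A] F₁'} {d : F₁' →ₗ[A] F₀'} {p : F₀' →ₗ[A] M} (hκ : Function.Injective κ)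
    (hκd : Function.Exact κ d) (hdp : Function.Exact d p) (hp : Function.Surjective p) :
    ∃ (f : M →ₗ[A] K × F₁') (g : K × F₁' →ₗ[A] M), g ∘ₗ f = LinearMap.id := by
  -- Two successive comparisons: first the image of d with L, then M with K, once F₀' has been added
  -- to both L and F₁.
  obtain ⟨a, b, hab⟩ := exists_retract_of_syzygy hi₀ h₀ hp₀
    (i' := (LinearMap.range d).subtype) (p' := p) Subtype.val_injective
    (fun x => by rw [hdp x]; simp) hp LinearMap.id LinearMap.id rfl
  refine exists_retract_of_syzygy (N := K) (F := F₁ × F₀') (Y := L × F₀')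
    (i := LinearMap.inl A F₁ F₀' ∘ₗ i₁) (p := p₁.prodMap LinearMap.id)
    (LinearMap.inl_injective.comp hi₁) ?_ (hp₁.prodMap Function.surjective_id) hκ
    (p' := d.rangeRestrict) ?_ d.surjective_rangeRestrict a b hab
  · rintro ⟨x, y⟩
    constructor
    · intro h
      obtain ⟨k, rfl⟩ := (h₁ x).1 (congrArg Prod.fst h)
      exact ⟨k, Prod.ext rfl (congrArg Prod.snd h).symm⟩
    · rintro ⟨k, hk⟩
      obtain ⟨rfl, rfl⟩ := Prod.ext_iff.1 hk
      exact Prod.ext (h₁.apply_apply_eq_zero k) rfl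
  · intro x
    rw [← hκd x]
    exact Subtype.ext_iff

section

variable {S : Type*} [CommRing S] {f : S} {M F : Type*} [AddCommGroup M] [Module S M]
  [AddCommGroup F] [Module S F]

/-- If `f` annihilates the cokernel `M` of `N → F`, then multiplication by `f` induces a map from
`M` to `N / f N`. -/
def toQuotSMulTopKer (f : S) (hf : ∀ x : M, f • x = 0) (π : F →ₗ[S] M)
    (hπ : Function.Surjective π) : M →ₗ[S] QuotSMulTop f (LinearMap.ker π) :=
  (LinearMap.ker π).liftQ
    ((f • (⊤ : Submodule S (LinearMap.ker π))).mkQ ∘ₗ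
      (LinearMap.lsmul S F f).codRestrict (LinearMap.ker π) fun v => by simp [hf])
    (fun v hv => by
      rw [LinearMap.mem_ker, LinearMap.comp_apply, Submodule.mkQ_apply,
        Submodule.Quotient.mk_eq_zero]
      exact Submodule.smul_mem_pointwise_smul (⟨v, hv⟩ : LinearMap.ker π) f ⊤ trivial) ∘ₗ
    (π.quotKerEquivOfSurjective hπ).symm.toLinearMap

variable (hf : ∀ x : M, f • x = 0) {π : F →ₗ[S] M} (hπ : Function.Surjective π)

lemma toQuotSMulTopKer_apply (v : F) : toQuotSMulTopKer f hf π hπ (π v) =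
    Submodule.Quotient.mk ⟨f • v, by simp [hf]⟩ := by
  have : (π.quotKerEquivOfSurjective hπ).symm (π v) = Submodule.Quotient.mk v := by
    rw [LinearEquiv.symm_apply_eq]; rfl
  rw [toQuotSMulTopKer, LinearMap.comp_apply, LinearEquiv.coe_coe, this]
  rfl

lemma toQuotSMulTopKer_injective (hF : IsSMulRegular F f) :
    Function.Injective (toQuotSMulTopKer f hf π hπ) := by
  rw [injective_iff_map_eq_zero]
  intro x
  obtain ⟨v, rfl⟩ := hπ x
  rw [toQuotSMulTopKer_apply, Submodule.Quotient.mk_eq_zero,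
    Submodule.mem_smul_pointwise_iff_exists]
  rintro ⟨w, -, hw⟩
  rw [← hF (congrArg Subtype.val hw)]
  exact w.2

lemma toQuotSMulTopKer_exact : Function.Exact (toQuotSMulTopKer f hf π hπ)
    (QuotSMulTop.map f (LinearMap.ker π).subtype) := by
  intro x
  obtain ⟨w, rfl⟩ := Submodule.Quotient.mk_surjective _ x
  rw [QuotSMulTop.map_apply_mk, Submodule.Quotient.mk_eq_zero,
    Submodule.mem_smul_pointwise_iff_exists]
  constructor
  · rintro ⟨v, -, hv⟩
    refine ⟨π v, ?_⟩
    rw [toQuotSMulTopKer_apply]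
    exact congrArg _ (Subtype.ext hv)
  · rintro ⟨y, hy⟩
    obtain ⟨v, rfl⟩ := hπ y
    rw [toQuotSMulTopKer_apply, ← sub_eq_zero, ← Submodule.Quotient.mk_sub,
      Submodule.Quotient.mk_eq_zero, Submodule.mem_smul_pointwise_iff_exists] at hy
    obtain ⟨z, -, hz⟩ := hy
    refine ⟨v - z, trivial, ?_⟩
    rw [smul_sub, sub_eq_iff_eq_add, ← sub_eq_iff_eq_add']
    exact (congrArg Subtype.val hz).symm

/-- The map from `F / f F` to a quotient `M` of `F` annihilated by `f`. -/
def ofQuotSMulTop (f : S) (hf : ∀ x : M, f • x = 0) (π : F →ₗ[S] M) : QuotSMulTop f F →ₗ[S] M :=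
  Submodule.liftQ _ π fun x hx => by
    obtain ⟨y, -, rfl⟩ := (Submodule.mem_smul_pointwise_iff_exists _ _ _).1 hx
    simp [hf]

lemma ofQuotSMulTop_exact : Function.Exact (QuotSMulTop.map f (LinearMap.ker π).subtype)
    (ofQuotSMulTop f hf π) := by
  intro x
  obtain ⟨v, rfl⟩ := Submodule.Quotient.mk_surjective _ x
  constructor
  · intro h
    exact ⟨Submodule.Quotient.mk ⟨v, h⟩, rfl⟩
  · rintro ⟨y, hy⟩
    obtain ⟨w, rfl⟩ := Submodule.Quotient.mk_surjective _ y
    rw [← hy]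
    exact w.2

end

variable {S : Type u} [CommRing S] [IsRegularLocalRing S] {f : S}
  {M : Type u} [AddCommGroup M] [Module S M] [Module (S ⧸ Ideal.span {f}) M]
  [IsScalarTower S (S ⧸ Ideal.span {f}) M] [Module.Finite S M]
  {K L F₁ F₀ : Type u} [AddCommGroup K] [Module (S ⧸ Ideal.span {f}) K]
  [AddCommGroup L] [Module (S ⧸ Ideal.span {f}) L]
  [AddCommGroup F₁] [Module (S ⧸ Ideal.span {f}) F₁]
  [AddCommGroup F₀] [Module (S ⧸ Ideal.span {f}) F₀]
  [Module.Projective (S ⧸ Ideal.span {f}) F₁] [Module.Projective (S ⧸ Ideal.span {f}) F₀]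

lemma depthGE_fin_fun (n : ℕ) : DepthGE (dimNat S) (ModuleCat.of S (Fin n → S)) := by
  induction n with
  | zero =>
    have : Subsingleton (ModuleCat.of S (Fin 0 → S)) := inferInstanceAs (Subsingleton (Fin 0 → S))
    exact .of_subsingleton _ _
  | succ n ih =>
    have h : DepthGE (dimNat S) (ModuleCat.of S (S × (Fin n → S))) :=
      .of_exact (X := ModuleCat.of S S) (Z := ModuleCat.of S (Fin n → S))
        (f := LinearMap.inl S S (Fin n → S)) (g := LinearMap.snd S S (Fin n → S))
        LinearMap.inl_injective .inl_snd LinearMap.snd_surjective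
        (depthGE_self_of_isRegularLocalRing S) ih
    let e := Fin.consLinearEquiv S fun _ : Fin (n + 1) => S
    exact h.of_retract (X := ModuleCat.of S (Fin (n + 1) → S)) e.symm.toLinearMap e.toLinearMap
      (by ext1 x; simp)

/-- The kernel N of Sⁿ → M has full depth, hence is free. As f kills M, multiplication by f maps Sⁿ
into N and yields the exact sequence 0 → M → N/fN → Sⁿ/fSⁿ → M → 0 with free middle terms. -/
lemma exists_retract_of_depthGE_of_ne_zero (hf : f ≠ 0) {d : ℕ} (hd : dimNat S ≤ d + 1)
    (hM : DepthGE d (ModuleCat.of S M))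
    {i₁ : K →ₗ[S ⧸ Ideal.span {f}] F₁} {p₁ : F₁ →ₗ[S ⧸ Ideal.span {f}] L}
    {i₀ : L →ₗ[S ⧸ Ideal.span {f}] F₀} {p₀ : F₀ →ₗ[S ⧸ Ideal.span {f}] M}
    (hi₁ : Function.Injective i₁) (h₁ : Function.Exact i₁ p₁) (hp₁ : Function.Surjective p₁)
    (hi₀ : Function.Injective i₀) (h₀ : Function.Exact i₀ p₀) (hp₀ : Function.Surjective p₀) :
    ∃ (l : ℕ) (a : M →ₗ[S ⧸ Ideal.span {f}] K × (Fin l → S ⧸ Ideal.span {f}))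
      (b : K × (Fin l → S ⧸ Ideal.span {f}) →ₗ[S ⧸ Ideal.span {f}] M), b ∘ₗ a = LinearMap.id := by
  have := isDomain_of_isRegularLocalRing S
  obtain ⟨n, π, hπ⟩ := Module.Finite.exists_fin' S M
  have hfM : ∀ x : M, f • x = 0 := fun x => by
    rw [← algebraMap_smul (S ⧸ Ideal.span {f}) f x, Ideal.Quotient.algebraMap_eq,
      Ideal.Quotient.eq_zero_iff_mem.2 (Ideal.mem_span_singleton_self f), zero_smul]
  have hker : Module.Free S (LinearMap.ker π) := by
    refine free_of_depthGE S _ ?_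
    rcases hS : dimNat S with _ | e
    · exact fun i hi => absurd hi (Nat.not_lt_zero i)
    · exact .of_exact_left (Y := ModuleCat.of S (Fin n → S)) (Z := ModuleCat.of S M)
        (f := (LinearMap.ker π).subtype) (g := π) Subtype.val_injective
        (LinearMap.exact_subtype_ker_map π) hπ (hS ▸ depthGE_fin_fun n) (hM.mono (by omega))
  have hs := Ideal.Quotient.mk_surjective (I := Ideal.span {f})
  have := Module.Finite.of_restrictScalars_finite S (S ⧸ Ideal.span {f})
    (QuotSMulTop f (LinearMap.ker π))
  obtain ⟨a, b, hab⟩ := exists_retract_of_periodic hi₁ h₁ hp₁ hi₀ h₀ hp₀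
    (F₁' := QuotSMulTop f (LinearMap.ker π)) (F₀' := QuotSMulTop f (Fin n → S))
    (κ := (toQuotSMulTopKer f hfM π hπ).extendScalarsOfSurjective hs)
    (d := (QuotSMulTop.map f (LinearMap.ker π).subtype).extendScalarsOfSurjective hs)
    (p := (ofQuotSMulTop f hfM π).extendScalarsOfSurjective hs)
    (toQuotSMulTopKer_injective hfM hπ fun x y h => by
      ext i; exact mul_left_cancel₀ hf (congrFun h i))
    (toQuotSMulTopKer_exact hfM hπ) (ofQuotSMulTop_exact hfM)
    (fun x => (hπ x).imp' Submodule.Quotient.mk fun _ h => h)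
  let e := ((Module.Free.chooseBasis (S ⧸ Ideal.span {f})
    (QuotSMulTop f (LinearMap.ker π))).reindex (Fintype.equivFin _)).equivFun
  refine ⟨_, (LinearMap.id.prodMap e.toLinearMap) ∘ₗ a,
    b ∘ₗ (LinearMap.id.prodMap e.symm.toLinearMap), ?_⟩
  ext x
  simpa using LinearMap.congr_fun hab x

/-- Here S/(f) is S itself and M is free, so the retraction uses only the free summand and is zero
on K. -/
lemma exists_retract_of_depthGE_zero (hM : DepthGE (dimNat S) (ModuleCat.of S M)) (hf : f = 0) :
    ∃ (l : ℕ) (a : M →ₗ[S ⧸ Ideal.span {f}] K × (Fin l → S ⧸ Ideal.span {f}))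
      (b : K × (Fin l → S ⧸ Ideal.span {f}) →ₗ[S ⧸ Ideal.span {f}] M), b ∘ₗ a = LinearMap.id := by
  have := free_of_depthGE S M hM
  let B := Module.finBasis S M
  have hbij : Function.Bijective (algebraMap S (S ⧸ Ideal.span {f})) := by
    refine ⟨(injective_iff_map_eq_zero _).2 fun x hx => ?_, Ideal.Quotient.mk_surjective⟩
    rw [Ideal.Quotient.algebraMap_eq, Ideal.Quotient.eq_zero_iff_mem, hf] at hx
    simpa using hx
  let B' := B.mapCoeffs (RingEquiv.ofBijective _ hbij) (algebraMap_smul (S ⧸ Ideal.span {f}))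
  refine ⟨_, LinearMap.inr _ _ _ ∘ₗ B'.equivFun.toLinearMap,
    B'.equivFun.symm.toLinearMap ∘ₗ LinearMap.snd _ _ _, ?_⟩
  ext x
  simp

end Periodicity
end CMRadius
namespace CMRadius

/-! ### Descending retracts along a flat local homomorphism -/

section Descent

open IsLocalRing RingTheory.Sequence TensorProduct

variable {R : Type*} [CommRing R] {A : Type*} [CommRing A] [Algebra R A]

lemma linearMapRightBaseChangeHom_comp {M M' N : Type*} [AddCommGroup M] [Module R M]
    [AddCommGroup M'] [Module R M'] [AddCommGroup N] [Module R N] (β : M' →ₗ[R] M)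
    (t : A ⊗[R] (M →ₗ[R] N)) :
    IsBaseChange.linearMapRightBaseChangeHom A M' (TensorProduct.mk R A N 1)
      ((LinearMap.lcomp R N β).lTensor A t) =
      IsBaseChange.linearMapRightBaseChangeHom A M (TensorProduct.mk R A N 1) t ∘ₗ β := by
  induction t using TensorProduct.induction_on with
  | zero => simp
  | tmul a g =>
    ext x
    simp [IsBaseChange.linearMapRightBaseChangeHom]
  | add x y hx hy => rw [map_add, map_add, hx, hy, map_add, LinearMap.add_comp]

/-- Homomorphisms out of a finitely presented module commute with flat base change. -/
lemma linearMapRightBaseChangeHom_surjective [Module.Flat R A] [IsNoetherianRing R]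
    (M N : Type*) [AddCommGroup M] [Module R M] [AddCommGroup N] [Module R N] [Module.Finite R M] :
    Function.Surjective
      (IsBaseChange.linearMapRightBaseChangeHom A M (TensorProduct.mk R A N 1)) := by
  intro ψ
  obtain ⟨b, β, hβ⟩ := Module.Finite.exists_fin' R M
  obtain ⟨a, α', hα'⟩ := Module.Finite.exists_fin' R (LinearMap.ker β)
  let α : (Fin a → R) →ₗ[R] (Fin b → R) := (LinearMap.ker β).subtype ∘ₗ α'
  have hαβ : Function.Exact α β := by
    intro x
    constructor
    · intro hx
      obtain ⟨y, hy⟩ := hα' ⟨x, hx⟩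
      exact ⟨y, congrArg Subtype.val hy⟩
    · rintro ⟨y, rfl⟩
      exact (α' y).2
  have hex : Function.Exact (LinearMap.lcomp R N β) (LinearMap.lcomp R N α) := by
    intro g
    constructor
    · intro hg
      have hk : LinearMap.ker β ≤ LinearMap.ker g := fun x hx => by
        obtain ⟨y, rfl⟩ := (hαβ x).1 hx
        exact LinearMap.congr_fun hg y
      refine ⟨(LinearMap.ker β).liftQ g hk ∘ₗ (β.quotKerEquivOfSurjective hβ).symm.toLinearMap, ?_⟩
      refine LinearMap.ext fun x => ?_
      have : (β.quotKerEquivOfSurjective hβ).symm (β x) = Submodule.Quotient.mk x := by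
        rw [LinearEquiv.symm_apply_eq]; rfl
      change (LinearMap.ker β).liftQ g hk ((β.quotKerEquivOfSurjective hβ).symm (β x)) = g x
      rw [this]
      rfl
    · rintro ⟨g, rfl⟩
      exact LinearMap.ext fun x => (congrArg g (hαβ.apply_apply_eq_zero x)).trans g.map_zero
  have hbc (k : ℕ) : Function.Bijective (IsBaseChange.linearMapRightBaseChangeHom A (Fin k → R)
      (TensorProduct.mk R A N 1)) :=
    (IsBaseChange.linearMapRightBaseChangeEquiv (Fin k → R) (TensorProduct.isBaseChange R N A)).bijective
  -- For free modules the comparison map is bijective. Flatness keeps Hom(M, N) → Hom(Rᵇ, N) →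
  -- Hom(Rᵃ, N) exact after base change, so a preimage of ψ ∘ β comes from Hom(M, N).
  obtain ⟨t, ht⟩ := (hbc b).2 (ψ ∘ₗ β)
  obtain ⟨s, rfl⟩ := (Module.Flat.lTensor_exact A hex t).1 <| (hbc a).1 <| by
    rw [linearMapRightBaseChangeHom_comp, ht, map_zero, LinearMap.comp_assoc,
      hαβ.linearMap_comp_eq_zero, LinearMap.comp_zero]
  refine ⟨s, ?_⟩
  rw [linearMapRightBaseChangeHom_comp] at ht
  ext x
  obtain ⟨y, rfl⟩ := hβ x
  exact LinearMap.congr_fun ht y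

variable [IsLocalRing A]

/-- Approximation of homomorphisms over `A` by homomorphisms over `R`. -/
lemma exists_linearMap_sub_mem [Module.Flat R A] [IsNoetherianRing R]
    (hres : ∀ a : A, ∃ r : R, a - algebraMap R A r ∈ maximalIdeal A)
    {M N : Type*} [AddCommGroup M] [Module R M] [AddCommGroup N] [Module R N] [Module.Finite R M]
    (φ : A ⊗[R] M →ₗ[A] A ⊗[R] N) :
    ∃ g : M →ₗ[R] N, ∀ y, φ y - g.baseChange A y ∈ maximalIdeal A • (⊤ : Submodule A (A ⊗[R] N)) := by
  suffices h : ∃ g : M →ₗ[R] N, ∀ x, φ (1 ⊗ₜ x) - 1 ⊗ₜ g x ∈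
      maximalIdeal A • (⊤ : Submodule A (A ⊗[R] N)) by
    obtain ⟨g, hg⟩ := h
    refine ⟨g, fun y => ?_⟩
    induction y using TensorProduct.induction_on with
    | zero => simp
    | tmul a x =>
      have : a ⊗ₜ[R] x = a • (1 : A) ⊗ₜ[R] x := by rw [smul_tmul', smul_eq_mul, mul_one]
      rw [this, map_smul, map_smul]
      exact (congrArg (· ∈ _) (smul_sub a (φ (1 ⊗ₜ[R] x)) (1 ⊗ₜ[R] g x))).mp
        (Submodule.smul_mem _ a (hg x))
    | add x y hx hy =>
      rw [map_add, map_add, add_sub_add_comm]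
      exact add_mem hx hy
  -- Now φ is an A-linear combination of maps defined over R; each coefficient is then replaced by
  -- an element of R with the same residue.
  obtain ⟨t, ht⟩ := linearMapRightBaseChangeHom_surjective (A := A) M N
    (φ.restrictScalars R ∘ₗ TensorProduct.mk R A M 1)
  have ht' : ∀ x, φ (1 ⊗ₜ x) = IsBaseChange.linearMapRightBaseChangeHom A M
    (TensorProduct.mk R A N 1) t x := fun x => (LinearMap.congr_fun ht x).symm
  simp only [ht']
  clear ht ht'
  induction t using TensorProduct.induction_on with
  | zero => exact ⟨0, by simp⟩
  | tmul a g =>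
    obtain ⟨r, hr⟩ := hres a
    refine ⟨r • g, fun x => ?_⟩
    have : IsBaseChange.linearMapRightBaseChangeHom A M (TensorProduct.mk R A N 1) (a ⊗ₜ[R] g) x -
        (1 : A) ⊗ₜ[R] ((r • g) x) = (a - algebraMap R A r) • ((1 : A) ⊗ₜ[R] g x) := by
      have h := sub_smul a (algebraMap R A r) ((1 : A) ⊗ₜ[R] g x)
      rw [algebraMap_smul] at h
      simpa [IsBaseChange.linearMapRightBaseChangeHom] using h.symm
    rw [this]
    exact Submodule.smul_mem_smul hr trivial
  | add s t hs ht =>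
    obtain ⟨g, hg⟩ := hs
    obtain ⟨g', hg'⟩ := ht
    refine ⟨g + g', fun x => ?_⟩
    rw [map_add, LinearMap.add_apply, LinearMap.add_apply, tmul_add, add_sub_add_comm]
    exact add_mem (hg x) (hg' x)

/-- Retracts descend along a flat local homomorphism inducing an isomorphism on residue fields. -/
lemma exists_retract_of_tensorProduct [IsLocalRing R] [Module.Flat R A] [IsNoetherianRing R]
    [IsLocalHom (algebraMap R A)]
    (hres : ∀ a : A, ∃ r : R, a - algebraMap R A r ∈ maximalIdeal A)
    {T W : Type*} [AddCommGroup T] [Module R T] [AddCommGroup W] [Module R W] [Module.Finite R T]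
    [Module.Finite R W] (a : A ⊗[R] T →ₗ[A] A ⊗[R] W) (b : A ⊗[R] W →ₗ[A] A ⊗[R] T)
    (hab : b ∘ₗ a = LinearMap.id) :
    ∃ (f : T →ₗ[R] W) (g : W →ₗ[R] T), g ∘ₗ f = LinearMap.id := by
  have : Module.FaithfullyFlat R A := .of_flat_of_isLocalHom
  obtain ⟨f, hf⟩ := exists_linearMap_sub_mem hres a
  obtain ⟨g, hg⟩ := exists_linearMap_sub_mem hres b
  -- The composite of the approximations is the identity modulo the maximal ideal, so Nakayama makes
  -- it surjective. Faithful flatness transfers this to g ∘ f, a surjective and hence bijective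
  -- endomorphism of a Noetherian module, whose inverse corrects g.
  have hle : (⊤ : Submodule A (A ⊗[R] T)) ≤ LinearMap.range ((g ∘ₗ f).baseChange A) := by
    refine Submodule.le_of_le_smul_of_le_jacobson_bot Module.Finite.fg_top
      (maximalIdeal_le_jacobson _) fun y _ => ?_
    have h₁ : b (a y - f.baseChange A y) ∈ maximalIdeal A • (⊤ : Submodule A (A ⊗[R] T)) := by
      have := Submodule.mem_map_of_mem (f := b) (hf y)
      rw [Submodule.map_smul''] at this
      exact Submodule.smul_mono le_rfl le_top this
    have h₂ := hg (f.baseChange A y)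
    have h₃ : y = (g ∘ₗ f).baseChange A y + (b (a y - f.baseChange A y) +
        (b (f.baseChange A y) - g.baseChange A (f.baseChange A y))) := by
      rw [LinearMap.baseChange_comp, LinearMap.comp_apply, map_sub,
        show b (a y) = y from LinearMap.congr_fun hab y]
      abel
    rw [h₃]
    exact Submodule.add_mem_sup ⟨y, rfl⟩ (add_mem h₁ h₂)
  have hsurj : Function.Surjective (g ∘ₗ f) :=
    (Module.FaithfullyFlat.lTensor_surjective_iff_surjective R A _).1
      (LinearMap.range_eq_top.1 (top_le_iff.1 hle) : Function.Surjective ((g ∘ₗ f).baseChange A))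
  let e := LinearEquiv.ofBijective _ (IsNoetherian.bijective_of_surjective_endomorphism _ hsurj)
  exact ⟨f, e.symm.toLinearMap ∘ₗ g, LinearMap.ext fun x => e.symm_apply_apply x⟩

end Descent

/-! ### Suspension closure over a hypersurface -/

section Hypersurface

open IsLocalRing RingTheory.Sequence TensorProduct

/-- The closed fibre is a field, so it contributes nothing to the height of the maximal ideal of A.
-/
lemma dimNat_le_of_map_maximalIdeal {R A : Type*} [CommRing R] [CommRing A] [Algebra R A]
    [IsLocalRing R] [IsNoetherianRing R] [IsLocalRing A] [IsNoetherianRing A]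
    (h : (maximalIdeal R).map (algebraMap R A) = maximalIdeal A) : dimNat A ≤ dimNat R := by
  have : IsLocalHom (algebraMap R A) := ((local_hom_TFAE _).out 0 2).2 h.le
  have : (maximalIdeal A).LiesOver (maximalIdeal R) := ⟨(maximalIdeal_comap _).symm⟩
  have h₁ := Ideal.height_le_height_add_of_liesOver (maximalIdeal R) (maximalIdeal A)
  have h₂ : (maximalIdeal A).map (Ideal.Quotient.mk ((maximalIdeal R).map (algebraMap R A))) = ⊥ := by
    rw [h, Ideal.map_quotient_self]
  have : Nontrivial (A ⧸ (maximalIdeal R).map (algebraMap R A)) :=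
    Ideal.Quotient.nontrivial_iff.2 (h ▸ (maximalIdeal.isMaximal A).ne_top)
  rw [h₂, Ideal.height_bot, add_zero] at h₁
  have h₃ : ringKrullDim A ≤ ringKrullDim R := by
    rw [← maximalIdeal_height_eq_ringKrullDim, ← maximalIdeal_height_eq_ringKrullDim]
    exact_mod_cast h₁
  rw [← coe_dimNat, ← coe_dimNat] at h₃
  exact_mod_cast h₃

lemma DepthGE.of_surjective {S A : Type u} [CommRing S] [CommRing A] [Algebra S A]
    [IsLocalRing S] [IsNoetherianRing S] [IsLocalRing A] [IsNoetherianRing A]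
    (hs : Function.Surjective (algebraMap S A)) {n : ℕ} {M : Type u} [AddCommGroup M] [Module S M]
    [Module A M] [IsScalarTower S A M] [Module.Finite S M] [Module.Finite A M]
    (hM : DepthGE n (ModuleCat.of A M)) : DepthGE n (ModuleCat.of S M) := by
  have : IsLocalHom (algebraMap S A) := .of_surjective _ hs
  obtain ⟨rs, h₁, h₂, h₃⟩ := (depthGE_iff n (ModuleCat.of A M)).1 hM
  obtain ⟨ts, rfl⟩ := List.map_surjective_iff.2 hs rs
  refine (depthGE_iff n _).2 ⟨ts, by simpa using h₁, fun r hr => ?_,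
    (isWeaklyRegular_map_algebraMap_iff A _ _).1 h₃⟩
  rw [← maximalIdeal_comap (algebraMap S A)]
  exact h₂ _ (List.mem_map_of_mem hr)

lemma DepthGE.tensorProduct {R A : Type u} [CommRing R] [CommRing A] [Algebra R A]
    [IsLocalRing R] [IsNoetherianRing R] [IsLocalRing A] [IsNoetherianRing A] [Module.Flat R A]
    [IsLocalHom (algebraMap R A)] {n : ℕ} {M : Type u} [AddCommGroup M] [Module R M]
    [Module.Finite R M] (hM : DepthGE n (ModuleCat.of R M)) :
    DepthGE n (ModuleCat.of A (A ⊗[R] M)) := by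
  obtain ⟨rs, h₁, h₂, h₃⟩ := (depthGE_iff n (ModuleCat.of R M)).1 hM
  refine (depthGE_iff n _).2 ⟨rs.map (algebraMap R A), by simpa, fun r hr => ?_,
    h₃.of_flat_of_isBaseChange (TensorProduct.isBaseChange R M A)⟩
  obtain ⟨s, hs, rfl⟩ := List.mem_map.1 hr
  exact map_nonunit (algebraMap R A) s (h₂ s hs)

/-- Second syzygies over a hypersurface are periodic up to retracts and free summands. -/
lemma exists_retract_of_dimNat_le {S : Type u} [CommRing S] [IsRegularLocalRing S] {f : S}
    [IsLocalRing (S ⧸ Ideal.span {f})] {M : Type u} [AddCommGroup M]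
    [Module (S ⧸ Ideal.span {f}) M] [Module.Finite (S ⧸ Ideal.span {f}) M]
    {K L F₁ F₀ : Type u} [AddCommGroup K] [Module (S ⧸ Ideal.span {f}) K]
    [AddCommGroup L] [Module (S ⧸ Ideal.span {f}) L]
    [AddCommGroup F₁] [Module (S ⧸ Ideal.span {f}) F₁]
    [AddCommGroup F₀] [Module (S ⧸ Ideal.span {f}) F₀]
    [Module.Projective (S ⧸ Ideal.span {f}) F₁] [Module.Projective (S ⧸ Ideal.span {f}) F₀]
    {d : ℕ} (hd : dimNat (S ⧸ Ideal.span {f}) ≤ d)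
    (hM : DepthGE d (ModuleCat.of (S ⧸ Ideal.span {f}) M))
    {i₁ : K →ₗ[S ⧸ Ideal.span {f}] F₁} {p₁ : F₁ →ₗ[S ⧸ Ideal.span {f}] L}
    {i₀ : L →ₗ[S ⧸ Ideal.span {f}] F₀} {p₀ : F₀ →ₗ[S ⧸ Ideal.span {f}] M}
    (hi₁ : Function.Injective i₁) (h₁ : Function.Exact i₁ p₁) (hp₁ : Function.Surjective p₁)
    (hi₀ : Function.Injective i₀) (h₀ : Function.Exact i₀ p₀) (hp₀ : Function.Surjective p₀) :
    ∃ (l : ℕ) (a : M →ₗ[S ⧸ Ideal.span {f}] K × (Fin l → S ⧸ Ideal.span {f}))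
      (b : K × (Fin l → S ⧸ Ideal.span {f}) →ₗ[S ⧸ Ideal.span {f}] M), b ∘ₗ a = LinearMap.id := by
  let _ : Module S M := Module.compHom M (algebraMap S (S ⧸ Ideal.span {f}))
  have : IsScalarTower S (S ⧸ Ideal.span {f}) M := .of_algebraMap_smul fun _ _ => rfl
  have : Module.Finite S M := .trans (S ⧸ Ideal.span {f}) M
  -- Regular sequences lift along the surjection S → S/(f), so M has the same depth bound over the
  -- regular ring.
  have hM' : DepthGE d (ModuleCat.of S M) := hM.of_surjective Ideal.Quotient.mk_surjective
  by_cases hf : f = 0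
  · refine exists_retract_of_depthGE_zero (hM'.mono (le_trans (le_of_eq ?_) hd)) hf
    have h : ringKrullDim S = ringKrullDim (S ⧸ Ideal.span {f}) := by
      refine ringKrullDim_eq_of_ringEquiv (RingEquiv.ofBijective (Ideal.Quotient.mk _)
        ⟨(injective_iff_map_eq_zero _).2 fun x hx => ?_, Ideal.Quotient.mk_surjective⟩)
      simpa [hf, Ideal.mem_span_singleton] using Ideal.Quotient.eq_zero_iff_mem.1 hx
    rw [← coe_dimNat, ← coe_dimNat (S ⧸ Ideal.span {f})] at h
    exact_mod_cast h
  · refine exists_retract_of_depthGE_of_ne_zero hf ?_ hM' hi₁ h₁ hp₁ hi₀ h₀ hp₀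
    have hfm : f ∈ maximalIdeal S := fun hu =>
      Ideal.Quotient.nontrivial_iff.1 (inferInstanceAs (Nontrivial (S ⧸ Ideal.span {f})))
        (Ideal.span_singleton_eq_top.2 hu)
    have h := ringKrullDim_le_ringKrullDim_quotSMulTop_succ hfm
    rw [← Submodule.ideal_span_singleton_smul, smul_eq_mul, Ideal.mul_top, ← coe_dimNat,
      ← coe_dimNat (S ⧸ Ideal.span {f})] at h
    exact le_trans (by exact_mod_cast h) (Nat.add_le_add_right hd 1)

/-- The class contains L = ΩT and hence K = ΩL. After base change T is a retract of K plus a free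
module; descent gives the same over R, and retract closure finishes. -/
lemma IsGood.of_cosyz_of_isCM {R : Type u} [CommRing R] [IsLocalRing R] [IsNoetherianRing R]
    {S : Type u} [CommRing S] [IsRegularLocalRing S] {f : S} [IsLocalRing (S ⧸ Ideal.span {f})]
    [Algebra R (S ⧸ Ideal.span {f})] [Module.Flat R (S ⧸ Ideal.span {f})]
    (hmax : (maximalIdeal R).map (algebraMap R (S ⧸ Ideal.span {f})) =
      maximalIdeal (S ⧸ Ideal.span {f}))
    (hres : ∀ a : S ⧸ Ideal.span {f},
      ∃ r : R, a - algebraMap R (S ⧸ Ideal.span {f}) r ∈ maximalIdeal (S ⧸ Ideal.span {f}))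
    {B : ObjectProperty (ModuleCat.{u} R)} (hB : IsGood B) {T : ModuleCat.{u} R} (hT : isCM R T)
    (hBT : cosyz B T) : B T := by
  obtain ⟨n, L, i₀, p₀, hi₀, h₀, hp₀, hL⟩ := hBT
  have := hB.finite hL
  have := hT.1
  obtain ⟨m, K, i₁, p₁, hi₁, h₁, hp₁⟩ := exists_presentation L
  have hK : B K := hB.syzygy_of_projective (F := ModuleCat.of R (Fin m → R)) hi₁ h₁ hp₁ hL
  have := hB.finite hK
  have : IsLocalHom (algebraMap R (S ⧸ Ideal.span {f})) := ((local_hom_TFAE _).out 0 2).2 hmax.le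
  obtain ⟨l, a, b, hab⟩ := exists_retract_of_dimNat_le (dimNat_le_of_map_maximalIdeal hmax)
    (M := (S ⧸ Ideal.span {f}) ⊗[R] T) (((isCM_iff T).1 hT).2.tensorProduct)
    (i₁ := i₁.baseChange (S ⧸ Ideal.span {f})) (p₁ := p₁.baseChange (S ⧸ Ideal.span {f}))
    (i₀ := i₀.baseChange (S ⧸ Ideal.span {f})) (p₀ := p₀.baseChange (S ⧸ Ideal.span {f}))
    (Module.Flat.lTensor_preserves_injective_linearMap _ hi₁) (Module.Flat.lTensor_exact _ h₁)
    (LinearMap.lTensor_surjective _ hp₁)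
    (Module.Flat.lTensor_preserves_injective_linearMap _ hi₀) (Module.Flat.lTensor_exact _ h₀)
    (LinearMap.lTensor_surjective _ hp₀)
  let e : (S ⧸ Ideal.span {f}) ⊗[R] (K × (Fin l → R)) ≃ₗ[S ⧸ Ideal.span {f}]
      ((S ⧸ Ideal.span {f}) ⊗[R] K) × (Fin l → S ⧸ Ideal.span {f}) :=
    (TensorProduct.prodRight R _ _ _ _).trans
      ((LinearEquiv.refl _ _).prodCongr (TensorProduct.piScalarRight R _ _ _))
  obtain ⟨g, h, hgh⟩ := exists_retract_of_tensorProduct hres (T := T) (W := K × (Fin l → R))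
    (e.symm.toLinearMap ∘ₗ a) (b ∘ₗ e.toLinearMap) (by
      refine LinearMap.ext fun x => ?_
      simpa using LinearMap.congr_fun hab x)
  exact hB.retract (Y := ModuleCat.of R (K × (Fin l → R))) g h hgh (hB.prod hK (hB.free l))

/-- Transported through the given isomorphism, the completion is flat over R, has the extended
maximal ideal and has the same residue field: the conditions under which descent works. -/
lemma IsHypersurface.of_cosyz_of_isCM {R : Type u} [CommRing R] [IsLocalRing R]
    [IsNoetherianRing R] (hR : IsHypersurface R) {B : ObjectProperty (ModuleCat.{u} R)}
    (hB : IsGood B) {T : ModuleCat.{u} R} (hT : isCM R T) (hBT : cosyz B T) : B T := by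
  obtain ⟨S, _, _, _, f, ⟨e⟩⟩ := hR
  let _ : Algebra R (S ⧸ Ideal.span {f}) :=
    (e.toRingHom.comp (algebraMap R (AdicCompletion (maximalIdeal R) R))).toAlgebra
  have := e.isLocalRing
  let e' : AdicCompletion (maximalIdeal R) R ≃ₐ[R] S ⧸ Ideal.span {f} :=
    AlgEquiv.ofRingEquiv (f := e) fun _ => rfl
  have : Module.Flat R (S ⧸ Ideal.span {f}) := .of_linearEquiv e'.symm.toLinearEquiv
  refine hB.of_cosyz_of_isCM (S := S) (f := f) ?_ (fun a => ?_) hT hBT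
  · rw [← map_ringEquiv_maximalIdeal e, AdicCompletion.maximalIdeal_eq_map]
    exact (Ideal.map_map (algebraMap R (AdicCompletion (maximalIdeal R) R)) e.toRingHom).symm
  · obtain ⟨r, hr⟩ := (AdicCompletion.residueField_map_bijective R).2 (residue _ (e.symm a))
    obtain ⟨r, rfl⟩ := residue_surjective r
    refine ⟨r, ?_⟩
    rw [ResidueField.map_residue, eq_comm, ← sub_eq_zero, ← map_sub, residue_eq_zero_iff] at hr
    rw [← map_ringEquiv_maximalIdeal e]
    convert Ideal.mem_map_of_mem e hr using 1
    rw [map_sub, e.apply_symm_apply]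
    rfl

end Hypersurface

end CMRadius

end

theorem mainTheorem10 (R : Type*) [CommRing R] [CMRadius.IsGorensteinLocalRing R] :
    CMRadius.stableDim R ≤ CMRadius.radius (CMRadius.isCM R) ∧
      (CMRadius.IsHypersurface R →
        CMRadius.stableDim R = CMRadius.radius (CMRadius.isCM R)) :=
  ⟨CMRadius.stableDim_le_radius R, fun h =>
    le_antisymm (CMRadius.stableDim_le_radius R)
      (CMRadius.radius_le_stableDim fun _ hB _ hT hBT => h.of_cosyz_of_isCM hB hT hBT)⟩
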